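/- **Setting.** A Kac process with parameters $a,c>0$ starting in $0$ is $K(t)=B\,c\,\tau_t$ with $\tau_t=\int_0^t(-1)^{N(s)}\,ds$, where $N$ is a homogeneous Poisson (counting) process of rate $a$ and $B$ is independent of $N$ with $\mathbb P(B=1)=\mathbb P(B=-1)=\tfrac12$. A $d$-dimensional Kac process $\mathbf K=(K^1,\dots,K^d)$ starting in $\mathbf 0$ has i.i.d. such components, with the same parameters $(a,c)$. $H^2(\mathbb R)$ is the space of twice weakly differentiable functions $f$ with $f,f',f''\in L_2(\mathbb R)$. **Theorem 5.5.** Let $d\ge 1$, $c_0>0$ and $\sigma>0$. There is a constant $C_d>0$ depending only on $d$, $c_0$, $\sigma$ such that the following holds. Let $f_0^1,\dots,f_0^d\in H^2(\mathbb R)$ be probability densities on $\mathbb R$. Then there is a function $R_d(a,c,t)$ (which may depend also on $d,c_0,\sigma,f_0^1,\dots,f_0^d$) with $$\lim_{a,c\uparrow\infty}R_d(a,c,t)=0\quad\text{for every }t>0,\qquad R_d(a,c,\cdot)\in\mathcal O\big(t^{-(\frac12+\frac d4)}\big)\ (t\to\infty)\quad\text{for all }a>0,\ c\ge c_0,$$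 such that for all $a>0$, $c\ge c_0$ with $\frac{c^2}{a}=\sigma^2$: if $\mathbf X_0=(X_0^1,\dots,X_0^d)$ is a random vector with independent components $X_0^i\sim f_0^i$ (that is, with density $f_0(x)=\prod_{i=1}^d f_0^i(x^i)$), $\mathbf K$ is a $d$-dimensional Kac process with parameters $(a,c)$ starting in $\mathbf 0$, $\mathbf W$ is a $d$-dimensional Wiener process, and for every $t\ge 0$ the vector $\mathbf X_0$ is independent of $\mathbf K(t)$ and of $\sigma\mathbf W(t)$, respectively, then for every $t\ge0$ the random vectors $\mathbf X_t=\mathbf X_0+\mathbf K(t)$ and $\mathbf X_0+\sigma\mathbf W(t)$ have probability densities $u_t$ and $h_t$ on $\mathbb R^d$, and $$\|h_t-u_t\|_{L_2(\mathbb R^d)}\le C_d\left(\frac1{a\,t^{1+\frac{d-1}4}}+\frac1{c\,a^{\frac12}\,t^{\frac12+\frac{d-1}4}}\right)+R_d(a,c,t)\qquad\text{for all }t>0.$$ Hence, for all such fixed $a,c$, $\ \|h_t-u_t\|_{L_2(\mathbb R^d)}=\mathcal O\big(t^{-(\frac12+\frac{d-1}4)}\big)$ as $t\to\infty$. -/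

import Mathlib

open MeasureTheory ProbabilityTheory Filter Topology Asymptotics
open scoped NNReal ENNReal

namespace KacFlow

noncomputable section

/-- `g` is a weak derivative of `f` on the real line. -/
def HasWeakDeriv (f g : ℝ → ℝ) : Prop :=
  LocallyIntegrable f volume ∧ LocallyIntegrable g volume ∧
    ∀ φ : ℝ → ℝ, ContDiff ℝ ((⊤ : ℕ∞) : WithTop ℕ∞) φ → HasCompactSupport φ →
      ∫ x, f x * deriv φ x = - ∫ x, g x * φ x

/-- The Sobolev space `H²(ℝ)`: twice weakly differentiable, with `f`, `f'`, `f''` in `L₂(ℝ)`. -/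
def MemH2 (f : ℝ → ℝ) : Prop :=
  MemLp f 2 volume ∧ ∃ f₁ f₂ : ℝ → ℝ, MemLp f₁ 2 volume ∧ MemLp f₂ 2 volume ∧
    HasWeakDeriv f f₁ ∧ HasWeakDeriv f₁ f₂

/-- `f` is a probability density on the real line (with respect to Lebesgue measure). -/
def IsProbDensity (f : ℝ → ℝ) : Prop :=
  AEMeasurable f volume ∧ 0 ≤ᵐ[volume] f ∧ ∫⁻ x, ENNReal.ofReal (f x) = 1

section Processes

variable {Ω : Type*} [MeasurableSpace Ω]

/-- Homogeneous Poisson point process with rate `a`: a counting process (almost all paths are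
nondecreasing and right-continuous with values in `ℕ`) that starts in `0` and has independent
increments with `N t - N s ∼ Poi (a (t - s))`. Since almost all paths are nondecreasing, the
truncated subtraction of `ℕ` is almost surely the true increment. -/
structure IsPoissonProcess (a : ℝ) (N : ℝ≥0 → Ω → ℕ) (P : Measure Ω) : Prop where
  measurable : ∀ t, Measurable (N t)
  path_mono : ∀ᵐ ω ∂P, Monotone fun t => N t ω
  path_rightCont : ∀ᵐ ω ∂P, ∀ t, ContinuousWithinAt (fun s => N s ω) (Set.Ici t) t
  start : ∀ᵐ ω ∂P, N 0 ω = 0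
  indep_increments : HasIndepIncrements N P
  law_increment : ∀ s t : ℝ≥0, s ≤ t →
    HasLaw (fun ω => N t ω - N s ω) (poissonMeasure (a.toNNReal * (t - s))) P

/-- The random time `τ_t = ∫₀ᵗ (-1)^{N(s)} ds`. -/
def randomTime (N : ℝ≥0 → Ω → ℕ) (t : ℝ≥0) (ω : Ω) : ℝ :=
  ∫ s in (0 : ℝ)..t, (-1 : ℝ) ^ N s.toNNReal ω

/-- The law of a symmetric sign: `±1` with probability `1/2` each. -/
def signLaw : Measure ℝ :=
  (2⁻¹ : ℝ≥0∞) • Measure.dirac (1 : ℝ) + (2⁻¹ : ℝ≥0∞) • Measure.dirac (-1 : ℝ)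

/-- One-dimensional Kac process with parameters `(a, c)` starting in `0`: `K(t) = B c τ_t`, where
`τ` is the random time of a Poisson process `N` with rate `a`, and `B` is a symmetric random sign
independent of `N`. -/
def IsKacProcess (a c : ℝ) (K : ℝ≥0 → Ω → ℝ) (P : Measure Ω) : Prop :=
  ∃ (N : ℝ≥0 → Ω → ℕ) (B : Ω → ℝ), IsPoissonProcess a N P ∧ Measurable B ∧
    HasLaw B signLaw P ∧ IndepFun B (fun ω t => N t ω) P ∧
    ∀ t ω, K t ω = B ω * (c * randomTime N t ω)

/-- `d`-dimensional Kac process starting in `0`: the components are independent one-dimensional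
Kac processes with the same parameters (independence is that of the whole paths). -/
structure IsKacProcessMulti {d : ℕ} (a c : ℝ) (K : ℝ≥0 → Ω → Fin d → ℝ) (P : Measure Ω) :
    Prop where
  component : ∀ i, IsKacProcess a c (fun t ω => K t ω i) P
  indep : iIndepFun (fun (i : Fin d) ω (t : ℝ≥0) => K t ω i) P

/-- `d`-dimensional Wiener process: starts in `0`, has independent increments,
`W(t) - W(s) ∼ 𝒩(0, (t - s) I_d)`, and almost surely continuous paths. -/
structure IsWienerProcess {d : ℕ} (W : ℝ≥0 → Ω → Fin d → ℝ) (P : Measure Ω) : Prop where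
  start : ∀ᵐ ω ∂P, W 0 ω = 0
  indep_increments : HasIndepIncrements W P
  law_increment : ∀ s t : ℝ≥0, s ≤ t →
    HasLaw (fun ω => W t ω - W s ω) (Measure.pi fun _ : Fin d => gaussianReal 0 (t - s)) P
  path_cont : ∀ᵐ ω ∂P, Continuous fun t => W t ω

/-- The `L₂(ℝ^d)` distance of the Lebesgue densities of two random vectors. -/
def densityL2Dist {d : ℕ} (Y Z : Ω → Fin d → ℝ) (P : Measure Ω) : ℝ≥0∞ :=
  eLpNorm (fun x => (pdf Y P volume x).toReal - (pdf Z P volume x).toReal) 2 volume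

end Processes

/-- The main term `1 / (a t^{1 + (d-1)/4}) + 1 / (c a^{1/2} t^{1/2 + (d-1)/4})`. -/
def mainTerm (d : ℕ) (a c t : ℝ) : ℝ :=
  1 / (a * t ^ (1 + ((d : ℝ) - 1) / 4)) +
    1 / (c * a ^ (1 / 2 : ℝ) * t ^ (1 / 2 + ((d : ℝ) - 1) / 4))

end

end KacFlow

/-! Everything is read off characteristic functions. With w = cξ, the independent symmetric sign
makes the characteristic function of K(t) at ξ equal to p(t) = E cos(w τ_t). Since (-1)^N flips at
rate a, p and q(t) = E[(-1)^{N(t)} sin(w τ_t)] satisfy p' = -w q, q' = w p - 2a q, the telegraph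
equation (`isTelegraphSolution`, `exists_charFun_eq`). For large a its slow mode decays at rate a -
√(a² - w²) ≈ w²/(2a) = σ²ξ²/2, which is the rate of the heat flow.

Quantitatively (`abs_sub_exp_le`), |p(t) - exp(-w²t/(2a))| is at most a Gaussian in ξ of height of
order 1/(at), plus 3 exp(-at/24) uniformly in ξ. The second term has no decay in ξ, as befits a law
with atoms at ±ct; it becomes square-integrable only through the factor given by the Fourier
transform of the initial density. Plancherel then yields the one-dimensional bounds of
`eLpNorm_dens_kac_bounds`: up to exponentially small terms, both smoothed densities have L² norm
O(t^{-1/4}) and their difference O(t^{-5/4}/a). The vectors have product laws, so exchanging one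
factor at a time (`eLpNorm_prod_sub_prod_le`) gives `distBound` in dimension d.

For t ≥ 1 the part of `distBound` free of the initial densities is dominated by the main term, and R
is what is left. For t < 1, R is all of `distBound`; this is harmless because the limit of R is
taken at fixed t and its order only as t → ∞. -/

namespace KacFlow

/-! ### The telegraph equation and its diffusive limit -/

/-- The first-order form of the telegraph equation `p'' + 2 a p' + w² p = 0`, with right
derivatives on `[0, ∞)`, started in `p = 1`, `p' = 0`. -/
structure IsTelegraphSolution (a w : ℝ) (p q : ℝ → ℝ) : Prop where
  contP : ContinuousOn p (Set.Ici 0)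
  contQ : ContinuousOn q (Set.Ici 0)
  derivP : ∀ t, 0 ≤ t → HasDerivWithinAt p (-w * q t) (Set.Ici t) t
  derivQ : ∀ t, 0 ≤ t → HasDerivWithinAt q (w * p t - 2 * a * q t) (Set.Ici t) t
  initP : p 0 = 1
  initQ : q 0 = 0

lemma le_of_deriv_right_nonpos {f f' : ℝ → ℝ} (hf : ContinuousOn f (Set.Ici 0))
    (hf' : ∀ t, 0 ≤ t → HasDerivWithinAt f (f' t) (Set.Ici t) t) (h : ∀ t, 0 ≤ t → f' t ≤ 0)
    {t : ℝ} (ht : 0 ≤ t) : f t ≤ f 0 :=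
  image_le_of_deriv_right_le_deriv_boundary (B := fun _ => f 0) (B' := fun _ => 0) (a := 0) (b := t)
    (hf.mono Set.Icc_subset_Ici_self) (fun x hx => hf' x hx.1) le_rfl continuousOn_const
    (fun x _ => hasDerivWithinAt_const x _ _) (fun x hx => h x hx.1) ⟨ht, le_rfl⟩

namespace IsTelegraphSolution

variable {a w : ℝ} {p q p₀ q₀ : ℝ → ℝ}

/-- The coupling terms cancel in the energy of the difference of two solutions, which leaves the
derivative -4a(q - q₀)² ≤ 0. -/
lemma unique (ha : 0 < a) (h : IsTelegraphSolution a w p q) (h₀ : IsTelegraphSolution a w p₀ q₀)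
    {t : ℝ} (ht : 0 ≤ t) : p t = p₀ t := by
  have key := le_of_deriv_right_nonpos (f := fun s => (p s - p₀ s) ^ 2 + (q s - q₀ s) ^ 2)
    (((h.contP.sub h₀.contP).pow 2).add ((h.contQ.sub h₀.contQ).pow 2))
    (fun s hs => (((h.derivP s hs).sub (h₀.derivP s hs)).pow 2).add
      (((h.derivQ s hs).sub (h₀.derivQ s hs)).pow 2))
    (fun s _ => by
      have : 0 ≤ a * (q s - q₀ s) ^ 2 := by positivity
      simp only [Nat.cast_ofNat, Nat.add_one_sub_one, pow_one, Pi.sub_apply]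
      nlinarith) ht
  simp only [h.initP, h.initQ, h₀.initP, h₀.initQ] at key
  have : (p t - p₀ t) ^ 2 ≤ 0 := by nlinarith [sq_nonneg (q t - q₀ t)]
  nlinarith [pow_eq_zero_iff (two_ne_zero) |>.1 (le_antisymm this (sq_nonneg _))]

/-- The energy p² + q² is damped only in q. The cross term -2δpq, of hypocoercive type, carries the
damping over to p, so that the modified energy V decays at rate a/12. This treats the oscillating,
critical and overdamped cases with |w| ≥ a/2 at once, without explicit solutions. -/
lemma abs_le_of_high (ha : 0 < a) (hw : a / 2 ≤ |w|) (h : IsTelegraphSolution a w p q)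
    {t : ℝ} (ht : 0 ≤ t) : |p t| ≤ 2 * Real.exp (-(a * t / 24)) := by
  have hw0 : w ≠ 0 := by
    rintro rfl
    simp only [abs_zero] at hw
    linarith
  -- The choice δw = a/10 gives the p² damping -2δw p² = -(a/5)p², while |w| ≥ a/2 gives |δ| ≤ 1/5
  -- and keeps V comparable to p² + q².
  set δ : ℝ := a / (10 * w) with hδ
  have hδw : δ * w = a / 10 := by rw [hδ]; field_simp
  have hδ1 : |δ| ≤ 1 / 5 := by
    have h1 : |δ| * |w| = a / 10 := by rw [← abs_mul, hδw, abs_of_pos (by positivity)]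
    have h2 : 0 < |w| := abs_pos.2 hw0
    by_contra hc
    push Not at hc
    nlinarith
  have hpq : ∀ x y : ℝ, |δ * (x * y)| ≤ (x ^ 2 + y ^ 2) / 10 := by
    intro x y
    have h1 : |x * y| ≤ (x ^ 2 + y ^ 2) / 2 := by
      rw [abs_le]; constructor <;> nlinarith [sq_nonneg (x + y), sq_nonneg (x - y)]
    rw [abs_mul]
    nlinarith [abs_nonneg δ, abs_nonneg (x * y)]
  set V : ℝ → ℝ := fun s => p s ^ 2 + q s ^ 2 - 2 * δ * (p s * q s) with hV
  have key := le_of_deriv_right_nonpos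
    (f := fun s => Real.exp (a * s / 12) * V s)
    ((by fun_prop : Continuous fun s : ℝ => Real.exp (a * s / 12)).continuousOn.mul
      (((h.contP.pow 2).add (h.contQ.pow 2)).sub (continuousOn_const.mul (h.contP.mul h.contQ))))
    (f' := fun s => Real.exp (a * s / 12) * (a / 12) * V s + Real.exp (a * s / 12) *
      (2 * p s * (-w * q s) + 2 * q s * (w * p s - 2 * a * q s) -
        2 * δ * ((-w * q s) * q s + p s * (w * p s - 2 * a * q s))))
    (fun s hs => by
      have h1 : HasDerivWithinAt (fun s : ℝ => Real.exp (a * s / 12))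
          (Real.exp (a * s / 12) * (a / 12)) (Set.Ici s) s := by
        have : HasDerivAt (fun s : ℝ => a * s / 12) (a / 12) s := by
          simpa using ((hasDerivAt_id s).const_mul a).div_const 12
        exact this.exp.hasDerivWithinAt
      have h2 := (((h.derivP s hs).pow 2).add ((h.derivQ s hs).pow 2)).sub
        (((h.derivP s hs).mul (h.derivQ s hs)).const_mul (2 * δ))
      refine (h1.mul h2).congr_deriv ?_
      simp [hV])
    (fun s _ => by
      have he := Real.exp_pos (a * s / 12)
      have hb := hpq (p s) (q s)
      have hx : a / 12 * V s + (2 * p s * (-w * q s) + 2 * q s * (w * p s - 2 * a * q s) -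
        2 * δ * ((-w * q s) * q s + p s * (w * p s - 2 * a * q s))) ≤ 0 := by
        have e : a / 12 * V s + (2 * p s * (-w * q s) + 2 * q s * (w * p s - 2 * a * q s) -
            2 * δ * ((-w * q s) * q s + p s * (w * p s - 2 * a * q s))) =
            a / 12 * V s - 4 * a * q s ^ 2 + 2 * (δ * w) * q s ^ 2 - 2 * (δ * w) * p s ^ 2
              + 4 * a * (δ * (p s * q s)) := by ring
        rw [e, hδw]
        -- The rescaling p/2, 2q makes the cross term 4aδpq cost only (a/10)p². The remaining
        -- (a/10)p² of damping pays exactly for (a/12)·(6/5)p², and q² has damping to spare.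
        have h5 : δ * (p s * q s) ≤ (p s ^ 2 + 16 * q s ^ 2) / 40 := by
          have := hpq (p s / 2) (q s * 2)
          have h6 := (abs_le.1 this).2
          nlinarith
        have hVs : V s ≤ 6 / 5 * (p s ^ 2 + q s ^ 2) := by
          have := (abs_le.1 hb).1
          simp only [hV]; nlinarith
        nlinarith [mul_le_mul_of_nonneg_left hVs ha.le, mul_le_mul_of_nonneg_left h5 ha.le,
          mul_nonneg ha.le (sq_nonneg (p s)), mul_nonneg ha.le (sq_nonneg (q s))]
      nlinarith) ht
  have hV0 : V 0 = 1 := by simp [hV, h.initP, h.initQ]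
  have hVt : 4 / 5 * p t ^ 2 ≤ V t := by
    have := (abs_le.1 (hpq (p t) (q t))).2
    simp only [hV]; nlinarith [sq_nonneg (q t)]
  simp only [hV0, mul_zero, zero_div, Real.exp_zero, one_mul] at key
  have hE : Real.exp (a * t / 12) * Real.exp (-(a * t / 24)) ^ 2 = 1 := by
    rw [← Real.exp_nat_mul, ← Real.exp_add]
    rw [← Real.exp_zero]; congr 1; push_cast; ring
  have he := Real.exp_pos (a * t / 12)
  refine abs_le_of_sq_le_sq ?_ (by positivity)
  have : Real.exp (a * t / 12) * p t ^ 2 ≤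
      Real.exp (a * t / 12) * (2 * Real.exp (-(a * t / 24))) ^ 2 := by
    rw [mul_pow]; nlinarith
  exact le_of_mul_le_mul_left this he

lemma explicit {μ : ℝ} (hμ : μ ≠ 0) (hμ2 : μ ^ 2 = a ^ 2 - w ^ 2) :
    IsTelegraphSolution a w
      (fun t => (1 + a / μ) / 2 * Real.exp (-(a - μ) * t) +
        (1 - a / μ) / 2 * Real.exp (-(a + μ) * t))
      (fun t => w / (2 * μ) * (Real.exp (-(a - μ) * t) - Real.exp (-(a + μ) * t))) where
  contP := by fun_prop
  contQ := by fun_prop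
  derivP t _ := by
    have h1 : HasDerivAt (fun t : ℝ => Real.exp (-(a - μ) * t))
        (Real.exp (-(a - μ) * t) * (-(a - μ))) t := by
      simpa using ((hasDerivAt_id t).const_mul (-(a - μ))).exp
    have h2 : HasDerivAt (fun t : ℝ => Real.exp (-(a + μ) * t))
        (Real.exp (-(a + μ) * t) * (-(a + μ))) t := by
      simpa using ((hasDerivAt_id t).const_mul (-(a + μ))).exp
    refine ((h1.const_mul _).add (h2.const_mul _)).hasDerivWithinAt.congr_deriv ?_
    generalize Real.exp (-(a - μ) * t) = x
    generalize Real.exp (-(a + μ) * t) = y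
    field_simp
    linear_combination (x - y) * hμ2
  derivQ t _ := by
    have h1 : HasDerivAt (fun t : ℝ => Real.exp (-(a - μ) * t))
        (Real.exp (-(a - μ) * t) * (-(a - μ))) t := by
      simpa using ((hasDerivAt_id t).const_mul (-(a - μ))).exp
    have h2 : HasDerivAt (fun t : ℝ => Real.exp (-(a + μ) * t))
        (Real.exp (-(a + μ) * t) * (-(a + μ))) t := by
      simpa using ((hasDerivAt_id t).const_mul (-(a + μ))).exp
    refine ((h1.sub h2).const_mul _).hasDerivWithinAt.congr_deriv ?_
    field_simp
    ring
  initP := by simp; ring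
  initQ := by simp

/-- For |w| ≤ a/2 both roots -(a ∓ μ) are real. The slow rate a - μ exceeds w²/(2a) by only (a -
μ)²/(2a), and the fast mode has amplitude (a/μ - 1)/2 of order w²/a². With s = w²t/a the error is at
most exp(-s/2)(s²/2 + 2s)/(at), and half of the exponential absorbs the polynomial. -/
lemma low_bounds (ha : 0 < a) (hw : |w| ≤ a / 2) (h : IsTelegraphSolution a w p q)
    {t : ℝ} (ht : 0 < t) :
    |p t - Real.exp (-(w ^ 2 * t / a / 2))| ≤ 16 / (a * t) * Real.exp (-(w ^ 2 * t / a / 4)) ∧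
      |p t| ≤ 2 * Real.exp (-(w ^ 2 * t / a / 4)) := by
  have hw2 : w ^ 2 ≤ a ^ 2 / 4 := by
    rw [← sq_abs]; nlinarith [abs_nonneg w]
  set μ := √(a ^ 2 - w ^ 2) with hμd
  have hμ2 : μ ^ 2 = a ^ 2 - w ^ 2 := Real.sq_sqrt (by nlinarith)
  have hμ34 : 3 / 4 * a ≤ μ := Real.le_sqrt_of_sq_le (by nlinarith)
  have hμ0 : 0 < μ := by linarith
  have hμa : μ ≤ a := by
    rw [hμd, Real.sqrt_le_left ha.le]; nlinarith [sq_nonneg w]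
  rw [h.unique ha (explicit hμ0.ne' hμ2) ht.le]
  set s := w ^ 2 * t / a with hs
  have hs0 : 0 ≤ s := by positivity
  -- the decay rate `a - μ` lies between `w²/(2a)` and `w²/a`
  have hl : (a - μ) * (a + μ) = w ^ 2 := by nlinarith
  have hl1 : w ^ 2 / (2 * a) ≤ a - μ := by
    rw [div_le_iff₀ (by positivity)]; nlinarith
  have hl2 : a - μ ≤ w ^ 2 / a := by
    rw [le_div_iff₀ ha]; nlinarith
  have hl3 : (a - μ) - w ^ 2 / (2 * a) = (a - μ) ^ 2 / (2 * a) := by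
    field_simp; nlinarith
  have hE1 : Real.exp (-(a - μ) * t) ≤ Real.exp (-(s / 2)) := by
    apply Real.exp_le_exp.2
    have : w ^ 2 / (2 * a) * t = s / 2 := by rw [hs]; field_simp
    nlinarith
  have hE2 : Real.exp (-(a + μ) * t) ≤ Real.exp (-(s / 2)) := by
    refine le_trans (Real.exp_le_exp.2 ?_) hE1
    nlinarith
  have hE3 : Real.exp (-(s / 2)) - Real.exp (-(a - μ) * t) ≤
      Real.exp (-(s / 2)) * (s ^ 2 / (2 * (a * t))) := by
    have e1 : Real.exp (-(a - μ) * t) =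
        Real.exp (-(s / 2)) * Real.exp (-((a - μ) ^ 2 / (2 * a) * t)) := by
      rw [← Real.exp_add]; congr 1
      rw [← hl3, hs]; field_simp; ring
    have e2 := Real.add_one_le_exp (-((a - μ) ^ 2 / (2 * a) * t))
    have e3 : (a - μ) ^ 2 / (2 * a) * t ≤ s ^ 2 / (2 * (a * t)) := by
      have : s ^ 2 / (2 * (a * t)) = (w ^ 2 / a) ^ 2 / (2 * a) * t := by
        rw [hs]; field_simp
      rw [this]
      have : (a - μ) ^ 2 ≤ (w ^ 2 / a) ^ 2 := pow_le_pow_left₀ (by linarith) hl2 2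
      gcongr
    rw [e1]
    nlinarith [Real.exp_pos (-(s / 2))]
  have hA : (a / μ - 1) ≤ 2 * (s / (a * t)) := by
    have : s / (a * t) = (w ^ 2 / a) / a := by rw [hs]; field_simp
    rw [this, div_sub_one hμ0.ne', div_le_iff₀ hμ0]
    have h1 : 0 ≤ w ^ 2 / a := by positivity
    have h2 : w ^ 2 / a / a * a = w ^ 2 / a := by field_simp
    have h3 : 0 ≤ w ^ 2 / a / a := by positivity
    nlinarith
  have hA0 : 0 ≤ a / μ - 1 := by rw [sub_nonneg, le_div_iff₀ hμ0]; linarith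
  have hA1 : a / μ - 1 ≤ 1 / 3 := by
    rw [div_sub_one hμ0.ne', div_le_iff₀ hμ0]; linarith
  have hP1 := Real.exp_pos (-(a - μ) * t)
  have hP2 := Real.exp_pos (-(a + μ) * t)
  have hP3 := Real.exp_pos (-(s / 2))
  have hsplit : Real.exp (-(s / 2)) = Real.exp (-(s / 4)) * Real.exp (-(s / 4)) := by
    rw [← Real.exp_add]; congr 1; ring
  have hq := Real.exp_pos (-(s / 4))
  -- This is 16 times the bound exp(x) ≥ 1 + x + x²/2 at x = s/4.
  have hpoly : Real.exp (-(s / 4)) * (s ^ 2 / 2 + 2 * s) ≤ 16 := by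
    have h1 := Real.quadratic_le_exp_of_nonneg (x := s / 4) (by positivity)
    have h2 : Real.exp (-(s / 4)) * Real.exp (s / 4) = 1 := by
      rw [← Real.exp_add]; simp
    nlinarith
  have hq1 : Real.exp (-(s / 4)) ≤ 1 := Real.exp_le_one_iff.2 (by linarith)
  constructor
  · have hat : 0 < a * t := by positivity
    have hb : |(1 + a / μ) / 2 * Real.exp (-(a - μ) * t) +
        (1 - a / μ) / 2 * Real.exp (-(a + μ) * t) - Real.exp (-(s / 2))| ≤
        Real.exp (-(s / 2)) * (s ^ 2 / (2 * (a * t)) + 2 * (s / (a * t))) := by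
      set A := a / μ - 1
      have e : (1 + a / μ) / 2 * Real.exp (-(a - μ) * t) +
        (1 - a / μ) / 2 * Real.exp (-(a + μ) * t) - Real.exp (-(s / 2)) =
        -(Real.exp (-(s / 2)) - Real.exp (-(a - μ) * t)) + A / 2 * Real.exp (-(a - μ) * t)
          - A / 2 * Real.exp (-(a + μ) * t) := by simp only [A]; ring
      have b1 : A / 2 * Real.exp (-(a - μ) * t) ≤ s / (a * t) * Real.exp (-(s / 2)) :=
        mul_le_mul (by linarith) hE1 hP1.le (by positivity)
      have b2 : A / 2 * Real.exp (-(a + μ) * t) ≤ s / (a * t) * Real.exp (-(s / 2)) :=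
        mul_le_mul (by linarith) hE2 hP2.le (by positivity)
      have b3 : 0 ≤ A / 2 * Real.exp (-(a - μ) * t) := by positivity
      have b4 : 0 ≤ A / 2 * Real.exp (-(a + μ) * t) := by positivity
      have b5 : 0 ≤ Real.exp (-(s / 2)) * (s ^ 2 / (2 * (a * t))) := by positivity
      rw [e, abs_le]
      constructor <;> linarith
    refine hb.trans ?_
    have : Real.exp (-(s / 2)) * (s ^ 2 / (2 * (a * t)) + 2 * (s / (a * t))) =
        (Real.exp (-(s / 4)) * (s ^ 2 / 2 + 2 * s)) / (a * t) * Real.exp (-(s / 4)) := by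
      rw [hsplit]; field_simp
    rw [this]
    gcongr
  · set A := a / μ - 1
    have e : (1 + a / μ) / 2 * Real.exp (-(a - μ) * t) +
        (1 - a / μ) / 2 * Real.exp (-(a + μ) * t) =
        Real.exp (-(a - μ) * t) + A / 2 * Real.exp (-(a - μ) * t)
          - A / 2 * Real.exp (-(a + μ) * t) := by simp only [A]; ring
    have hE4 : Real.exp (-(s / 2)) ≤ Real.exp (-(s / 4)) := Real.exp_le_exp.2 (by linarith)
    have b1 : A / 2 * Real.exp (-(a - μ) * t) ≤ 1 / 6 * Real.exp (-(s / 2)) :=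
      mul_le_mul (by linarith) hE1 hP1.le (by positivity)
    have b2 : A / 2 * Real.exp (-(a + μ) * t) ≤ 1 / 6 * Real.exp (-(s / 2)) :=
      mul_le_mul (by linarith) hE2 hP2.le (by positivity)
    have b3 : 0 ≤ A / 2 * Real.exp (-(a - μ) * t) := by positivity
    have b4 : 0 ≤ A / 2 * Real.exp (-(a + μ) * t) := by positivity
    rw [e, abs_le]
    constructor <;> linarith

/-- Diffusive approximation of the solution of the telegraph equation. -/
lemma abs_sub_exp_le (ha : 0 < a) (h : IsTelegraphSolution a w p q) {t : ℝ} (ht : 0 < t) :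
    |p t - Real.exp (-(w ^ 2 * t / a / 2))| ≤
      16 / (a * t) * Real.exp (-(w ^ 2 * t / a / 4)) + 3 * Real.exp (-(a * t / 24)) := by
  have hat : 0 < a * t := by positivity
  rcases le_total |w| (a / 2) with hw | hw
  · exact (h.low_bounds ha hw ht).1.trans (by linarith [Real.exp_pos (-(a * t / 24))])
  · have h1 := h.abs_le_of_high ha hw ht.le
    -- At high frequency the Gaussian is itself negligible; together with the factor 2 for p this
    -- gives the constant 3.
    have h2 : Real.exp (-(w ^ 2 * t / a / 2)) ≤ Real.exp (-(a * t / 24)) := by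
      apply Real.exp_le_exp.2
      have hw2 : a ^ 2 / 4 ≤ w ^ 2 := by rw [← sq_abs w]; nlinarith
      have : a * t / 4 ≤ w ^ 2 * t / a := by
        rw [le_div_iff₀ ha]; nlinarith
      linarith
    have h3 : 0 ≤ 16 / (a * t) * Real.exp (-(w ^ 2 * t / a / 4)) := by positivity
    calc _ ≤ |p t| + |Real.exp (-(w ^ 2 * t / a / 2))| := abs_sub _ _
      _ ≤ _ := by rw [abs_of_pos (Real.exp_pos _)]; linarith

lemma abs_le_exp (ha : 0 < a) (h : IsTelegraphSolution a w p q) {t : ℝ} (ht : 0 < t) :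
    |p t| ≤ 2 * Real.exp (-(w ^ 2 * t / a / 4)) + 2 * Real.exp (-(a * t / 24)) := by
  rcases le_total |w| (a / 2) with hw | hw
  · exact (h.low_bounds ha hw ht).2.trans (by linarith [Real.exp_pos (-(a * t / 24))])
  · exact (h.abs_le_of_high ha hw ht.le).trans
      (by linarith [Real.exp_pos (-(w ^ 2 * t / a / 4))])

end IsTelegraphSolution

/-! ### Occupation integrals along a counting path -/

/-- The sign `(-1) ^ M(r)` along a path `M`. -/
noncomputable def pathSign (M : ℝ≥0 → ℕ) (r : ℝ) : ℝ := (-1 : ℝ) ^ M r.toNNReal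

/-- The occupation integral `∫₀ᵗ (-1) ^ M(s) ds` of a path `M`. -/
noncomputable def pathTime (M : ℝ≥0 → ℕ) (t : ℝ) : ℝ := ∫ s in (0 : ℝ)..t, pathSign M s

lemma abs_pathSign (M : ℝ≥0 → ℕ) (r : ℝ) : |pathSign M r| = 1 := by
  simp [pathSign, abs_pow]

lemma pathSign_mul_self (M : ℝ≥0 → ℕ) (r : ℝ) : pathSign M r * pathSign M r = 1 := by
  rw [pathSign, ← pow_add, Even.neg_one_pow ⟨_, rfl⟩]

lemma pathTime_zero (M : ℝ≥0 → ℕ) : pathTime M 0 = 0 := by simp [pathTime]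

section Path

variable {M : ℝ≥0 → ℕ}

lemma measurable_pathSign (hM : Monotone M) : Measurable (pathSign M) := by
  have h : Measurable fun r : ℝ => M r.toNNReal :=
    Monotone.measurable fun _ _ hxy => hM (Real.toNNReal_mono hxy)
  exact (Measurable.of_discrete (f := fun n : ℕ => (-1 : ℝ) ^ n)).comp h

lemma intervalIntegrable_pathSign (hM : Monotone M) (s t : ℝ) :
    IntervalIntegrable (pathSign M) volume s t := by
  refine (intervalIntegrable_const (c := (1 : ℝ))).mono_fun
    (measurable_pathSign hM).aestronglyMeasurable (ae_of_all _ fun r => ?_)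
  simp [abs_pathSign]

lemma abs_pathTime_sub_le (hM : Monotone M) (s t : ℝ) :
    |pathTime M t - pathTime M s| ≤ |t - s| := by
  rw [pathTime, pathTime, intervalIntegral.integral_interval_sub_left
    (intervalIntegrable_pathSign hM _ _) (intervalIntegrable_pathSign hM _ _)]
  have := intervalIntegral.norm_integral_le_of_norm_le_const (a := s) (b := t) (C := 1)
    (f := pathSign M) (fun x _ => by simp [abs_pathSign])
  simpa using this

lemma continuousWithinAt_comp_toNNReal (hc : ∀ t, ContinuousWithinAt M (Set.Ici t) t) (t : ℝ) :
    ContinuousWithinAt (fun r : ℝ => M r.toNNReal) (Set.Ici t) t :=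
  (hc t.toNNReal).comp continuous_real_toNNReal.continuousWithinAt
    fun _ hr => Real.toNNReal_mono hr

lemma continuousWithinAt_pathSign (hc : ∀ t, ContinuousWithinAt M (Set.Ici t) t) (t : ℝ) :
    ContinuousWithinAt (pathSign M) (Set.Ici t) t :=
  (continuous_of_discreteTopology (f := fun n : ℕ => (-1 : ℝ) ^ n)).continuousAt
    |>.comp_continuousWithinAt (continuousWithinAt_comp_toNNReal hc t)

/-- Paths are only right-continuous, so only the right derivative is available at jump times. This
is why the telegraph system is stated with right derivatives. -/
lemma hasDerivWithinAt_pathTime (hM : Monotone M)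
    (hc : ∀ t, ContinuousWithinAt M (Set.Ici t) t) (t : ℝ) :
    HasDerivWithinAt (pathTime M) (pathSign M t) (Set.Ici t) t :=
  intervalIntegral.integral_hasDerivWithinAt_right (intervalIntegrable_pathSign hM _ _)
    (measurable_pathSign hM).stronglyMeasurable.stronglyMeasurableAtFilter
    ((continuousWithinAt_pathSign hc t).mono Set.Ioi_subset_Ici_self)

end Path

/-! ### Riemann sums of the random time over finite grids -/

section Grid

/-- The number of grid points of mesh `1/(n+1)` needed to cover `[0, s]`. -/
noncomputable def gridSize (s : ℝ≥0) (n : ℕ) : ℕ := (n + 1) * ⌈s⌉₊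

/-- The grid of mesh `1/(n+1)` on `[0, s]`, constant equal to `s` from `gridSize s n` on. -/
noncomputable def grid (s : ℝ≥0) (n k : ℕ) : ℝ≥0 := min s (k / (n + 1))

/-- The index of the grid point to the right of `r`. -/
noncomputable def gridIndex (s : ℝ≥0) (n : ℕ) (r : ℝ) : Fin (gridSize s n + 1) :=
  ⟨min (⌊(n + 1) * r⌋₊ + 1) (gridSize s n), Nat.lt_succ_of_le (min_le_right _ _)⟩

lemma monotone_grid (s : ℝ≥0) (n : ℕ) : Monotone (grid s n) := by
  intro k l h
  have : (k : ℝ≥0) ≤ l := by exact_mod_cast h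
  unfold grid
  gcongr

lemma grid_zero (s : ℝ≥0) (n : ℕ) : grid s n 0 = 0 := by simp [grid]

lemma grid_gridSize (s : ℝ≥0) (n : ℕ) : grid s n (gridSize s n) = s := by
  refine min_eq_left ?_
  rw [le_div_iff₀ (by positivity), gridSize]
  push_cast
  rw [mul_comm]
  gcongr
  exact Nat.le_ceil s

lemma measurable_gridIndex (s : ℝ≥0) (n : ℕ) : Measurable (gridIndex s n) := by
  have h : Measurable fun r : ℝ => ⌊((n : ℝ) + 1) * r⌋₊ :=
    Nat.measurable_floor.comp (measurable_const.mul measurable_id)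
  exact (Measurable.of_discrete (f := fun k : ℕ =>
    (⟨min (k + 1) (gridSize s n), Nat.lt_succ_of_le (min_le_right _ _)⟩ :
      Fin (gridSize s n + 1)))).comp h

lemma grid_gridIndex_bounds {s : ℝ≥0} {r : ℝ} (hr : 0 ≤ r) (hrs : r < s) (n : ℕ) :
    r ≤ grid s n (gridIndex s n r) ∧ (grid s n (gridIndex s n r) : ℝ) ≤ r + 1 / (n + 1) := by
  have h0 : (0 : ℝ) < n + 1 := by positivity
  have hf := Nat.lt_floor_add_one ((n + 1) * r)
  have hf2 := Nat.floor_le (a := (n + 1) * r) (by positivity)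
  have e : grid s n (gridIndex s n r) = grid s n (⌊(n + 1) * r⌋₊ + 1) := by
    rcases le_total (⌊(n + 1) * r⌋₊ + 1) (gridSize s n) with h | h
    · simp [gridIndex, h]
    · have : grid s n (⌊(n + 1) * r⌋₊ + 1) = s :=
        le_antisymm (min_le_left _ _) ((grid_gridSize s n).symm.le.trans (monotone_grid s n h))
      rw [this]
      simp [gridIndex, h, grid_gridSize]
  rw [e, grid]
  push_cast
  refine ⟨le_min hrs.le ?_, (min_le_right _ _).trans ?_⟩
  · rw [le_div_iff₀ h0]; linarith
  · have e' : (r + 1 / (n + 1)) * (n + 1) = (n + 1) * r + 1 := by field_simp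
    rw [div_le_iff₀ h0, e']; linarith

/-- The Riemann sum approximation of `pathTime` as a function of the values on the grid. -/
noncomputable def gridTime (s : ℝ≥0) (n : ℕ) (v : Fin (gridSize s n + 1) → ℕ) : ℝ :=
  ∫ r in (0 : ℝ)..s, (-1 : ℝ) ^ v (gridIndex s n r)

/-- Sampling at the grid point to the right of r makes right continuity sufficient. The limit
expresses τ_s through finitely many values of N at a time, the form in which measurability and
independence are accessible. -/
lemma tendsto_gridTime {M : ℝ≥0 → ℕ} (hc : ∀ t, ContinuousWithinAt M (Set.Ici t) t) (s : ℝ≥0) :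
    Tendsto (fun n => gridTime s n fun k => M (grid s n k)) atTop (𝓝 (pathTime M s)) := by
  refine intervalIntegral.tendsto_integral_filter_of_dominated_convergence (fun _ => 1)
    (Eventually.of_forall fun n => ?_) (Eventually.of_forall fun n => ae_of_all _ fun r _ => ?_)
    intervalIntegrable_const ?_
  · exact ((Measurable.of_discrete (f := fun k : Fin (gridSize s n + 1) =>
      (-1 : ℝ) ^ M (grid s n k))).comp (measurable_gridIndex s n)).aestronglyMeasurable
  · simp
  · have hs : ∀ᵐ r : ℝ, r ≠ s := by simp [ae_iff, measure_singleton]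
    filter_upwards [hs] with r hrs hr
    rw [Set.uIoc_of_le (NNReal.coe_nonneg s)] at hr
    have hr0 : 0 ≤ r := hr.1.le
    have hr1 : r < s := lt_of_le_of_ne hr.2 hrs
    have hg : Tendsto (fun n => ((grid s n (gridIndex s n r) : ℝ≥0) : ℝ)) atTop
        (𝓝[Set.Ici r] r) := by
      refine tendsto_nhdsWithin_iff.2 ⟨?_, Eventually.of_forall fun n =>
        (grid_gridIndex_bounds hr0 hr1 n).1⟩
      refine tendsto_of_tendsto_of_tendsto_of_le_of_le tendsto_const_nhds ?_
        (fun n => (grid_gridIndex_bounds hr0 hr1 n).1)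
        (fun n => (grid_gridIndex_bounds hr0 hr1 n).2)
      simpa using tendsto_const_nhds.add (tendsto_one_div_add_atTop_nhds_zero_nat (𝕜 := ℝ))
    have := (continuousWithinAt_pathSign hc r).tendsto.comp hg
    simpa [Function.comp_def, pathSign] using this

end Grid

/-! ### Poisson signs and independence from the sampled past -/

section Poisson

variable {Ω : Type*} [MeasurableSpace Ω] {P : Measure Ω} {a : ℝ} {N : ℝ≥0 → Ω → ℕ}

omit [MeasurableSpace Ω] in
lemma randomTime_eq (N : ℝ≥0 → Ω → ℕ) (t : ℝ≥0) (ω : Ω) :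
    randomTime N t ω = pathTime (fun s => N s ω) t := rfl

/-- The values of a counting process on a grid. -/
noncomputable def gridValues (N : ℝ≥0 → Ω → ℕ) (s : ℝ≥0) (n : ℕ) (ω : Ω) :
    Fin (gridSize s n + 1) → ℕ := fun k => N (grid s n k) ω

/-- The generating function exp(r(z - 1)) at z = -1; this is the source of the damping 2a. -/
lemma integral_neg_one_pow_poissonMeasure (r : ℝ≥0) :
    ∫ n, (-1 : ℝ) ^ n ∂(poissonMeasure r) = Real.exp (-2 * r) := by
  rw [integral_poissonMeasure]
  have h := (NormedSpace.expSeries_div_hasSum_exp (-(r : ℝ))).mul_left (Real.exp (-r))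
  rw [← Real.exp_eq_exp_ℝ, ← Real.exp_add] at h
  rw [show -2 * (r : ℝ) = -r + -r by ring, ← h.tsum_eq]
  congr 1 with n
  rw [neg_pow (r : ℝ) n, smul_eq_mul]
  ring

namespace IsPoissonProcess

lemma measurable_gridValues (h : IsPoissonProcess a N P) (s : ℝ≥0) (n : ℕ) :
    Measurable (gridValues N s n) := measurable_pi_lambda _ fun _ => h.measurable _

lemma ae_tendsto_gridTime (h : IsPoissonProcess a N P) (s : ℝ≥0) :
    ∀ᵐ ω ∂P, Tendsto (fun n => gridTime s n (gridValues N s n ω)) atTop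
      (𝓝 (randomTime N s ω)) := by
  filter_upwards [h.path_rightCont] with ω hω using tendsto_gridTime hω s

lemma measurable_gridTime (h : IsPoissonProcess a N P) (s : ℝ≥0) (n : ℕ) :
    Measurable fun ω => gridTime s n (gridValues N s n ω) :=
  (Measurable.of_discrete (f := gridTime s n)).comp (h.measurable_gridValues s n)

lemma aemeasurable_randomTime (h : IsPoissonProcess a N P) (s : ℝ≥0) :
    AEMeasurable (randomTime N s) P :=
  aemeasurable_of_tendsto_metrizable_ae atTop
    (fun n => (h.measurable_gridTime s n).aemeasurable) (h.ae_tendsto_gridTime s)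

/-- Append t to the grid of [0, s] as the point after the last one. The grid values are partial sums
of the first m increments, and these are independent of increment m, which runs from s to t. -/
lemma indepFun_grid_increment (h : IsPoissonProcess a N P) {s t : ℝ≥0} (hst : s ≤ t) (n : ℕ) :
    IndepFun (gridValues N s n) (fun ω => N t ω - N s ω) P := by
  set m := gridSize s n with hm
  set u : ℕ → ℝ≥0 := fun k => if k ≤ m then grid s n k else t with hu
  have hmono : Monotone u := by
    intro k l hkl
    simp only [hu]
    split_ifs with h1 h2 h2
    · exact monotone_grid s n hkl
    · exact (min_le_left _ _).trans hst
    · omega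
    · exact le_rfl
  have hi := h.indep_increments.nat hmono
  have hmeas : ∀ i, Measurable fun ω => N (u (i + 1)) ω - N (u i) ω :=
    fun i => (h.measurable _).sub (h.measurable _)
  have h2 := hi.indepFun_finset (Finset.range m) {m} (by simp) hmeas
  have h3 := h2.comp
    (φ := fun v : Finset.range m → ℕ => fun k : Fin (m + 1) =>
      ∑ j ∈ (Finset.range k).attach, v ⟨j, Finset.mem_range.2
        ((Finset.mem_range.1 j.2).trans_le (Nat.lt_succ_iff.1 k.2))⟩)
    (ψ := fun v : ({m} : Finset ℕ) → ℕ => v ⟨m, by simp⟩)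
    Measurable.of_discrete Measurable.of_discrete
  refine h3.congr ?_ ?_
  -- Truncated differences telescope only along monotone paths, and the sum is the value itself only
  -- when the path starts in 0; hence the identification is almost sure.
  · filter_upwards [h.path_mono, h.start] with ω hω hω0
    funext k
    have hk : (k : ℕ) ≤ m := Nat.lt_succ_iff.1 k.2
    simp only [Function.comp_apply, gridValues]
    rw [Finset.sum_attach (Finset.range k) fun j => N (u (j + 1)) ω - N (u j) ω,
      Finset.sum_range_tsub (f := fun j => N (u j) ω) (hω.comp hmono)]
    simp [hu, hk, grid_zero, hω0]
  · refine ae_of_all _ fun ω => ?_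
    have e : u m = s := by simp [hu, hm, grid_gridSize]
    have e' : u (m + 1) = t := by simp [hu]
    simp only [Function.comp_apply, e, e']

end IsPoissonProcess

end Poisson

/-! ### The trigonometric means of the random time solve the telegraph equation -/

lemma abs_sin_sub_sin_le (x y : ℝ) : |Real.sin x - Real.sin y| ≤ |x - y| := by
  have := Convex.norm_image_sub_le_of_norm_deriv_le (f := Real.sin) (s := Set.univ) (C := 1)
    (x := y) (y := x) (fun _ _ => Real.differentiableAt_sin)
    (fun z _ => by simpa using Real.abs_cos_le_one z) convex_univ trivial trivial
  simpa using this

lemma abs_cos_sub_cos_le (x y : ℝ) : |Real.cos x - Real.cos y| ≤ |x - y| := by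
  have := Convex.norm_image_sub_le_of_norm_deriv_le (f := Real.cos) (s := Set.univ) (C := 1)
    (x := y) (y := x) (fun _ _ => Real.differentiableAt_cos)
    (fun z _ => by simpa using Real.abs_sin_le_one z) convex_univ trivial trivial
  simpa using this

section

variable {Ω : Type*} [MeasurableSpace Ω] {P : Measure Ω} {a : ℝ} {N : ℝ≥0 → Ω → ℕ}

/-- The real part `E cos (w τ_t)` of the characteristic function of the random time. -/
noncomputable def cosMean (N : ℝ≥0 → Ω → ℕ) (P : Measure Ω) (w t : ℝ) : ℝ :=
  ∫ ω, Real.cos (w * pathTime (fun s => N s ω) t) ∂P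

/-- The signed mean `E [(-1)^{N(t)} sin (w τ_t)]`. -/
noncomputable def sinMean (N : ℝ≥0 → Ω → ℕ) (P : Measure Ω) (w t : ℝ) : ℝ :=
  ∫ ω, pathSign (fun s => N s ω) t * Real.sin (w * pathTime (fun s => N s ω) t) ∂P

namespace IsPoissonProcess

lemma measurable_pathSign (h : IsPoissonProcess a N P) (t : ℝ) :
    Measurable fun ω => pathSign (fun s => N s ω) t :=
  (Measurable.of_discrete (f := fun n : ℕ => (-1 : ℝ) ^ n)).comp (h.measurable _)

lemma aemeasurable_pathTime (h : IsPoissonProcess a N P) {t : ℝ} (ht : 0 ≤ t) :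
    AEMeasurable (fun ω => pathTime (fun s => N s ω) t) P := by
  have := h.aemeasurable_randomTime t.toNNReal
  simpa only [funext (randomTime_eq N t.toNNReal), Real.coe_toNNReal t ht] using this

/-- Markov property at time `s`, tested against the sign of the increment. -/
lemma integral_pathSign_mul_sin [IsProbabilityMeasure P] (h : IsPoissonProcess a N P) (ha : 0 ≤ a)
    (w : ℝ) {s t : ℝ} (hs : 0 ≤ s) (hst : s ≤ t) :
    ∫ ω, pathSign (fun s => N s ω) t * Real.sin (w * pathTime (fun s => N s ω) s) ∂P =
      Real.exp (-2 * a * (t - s)) * sinMean N P w s := by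
  set s' := s.toNNReal with hs'
  set t' := t.toNNReal with ht'
  have es : (s' : ℝ) = s := Real.coe_toNNReal s hs
  have et : (t' : ℝ) = t := Real.coe_toNNReal t (hs.trans hst)
  have hst' : s' ≤ t' := Real.toNNReal_mono hst
  -- Factor (-1)^{N(t)} as (-1)^{N(s)} D. The approximations H n see only the grid of [0, s] and are
  -- independent of D, so the expectation factors before n → ∞.
  set D : Ω → ℝ := fun ω => (-1 : ℝ) ^ (N t' ω - N s' ω) with hD
  set H : ℕ → Ω → ℝ := fun n ω => (-1 : ℝ) ^ gridValues N s' n ω (Fin.last _) *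
    Real.sin (w * gridTime s' n (gridValues N s' n ω)) with hH
  have hHm : ∀ n, Measurable (H n) := fun n =>
    (Measurable.of_discrete (f := fun v : Fin (gridSize s' n + 1) → ℕ =>
      (-1 : ℝ) ^ v (Fin.last _) * Real.sin (w * gridTime s' n v))).comp
      (h.measurable_gridValues s' n)
  have hDm : Measurable D := (Measurable.of_discrete (f := fun n : ℕ => (-1 : ℝ) ^ n)).comp
    ((h.measurable _).sub (h.measurable _))
  have hH1 : ∀ n ω, ‖H n ω‖ ≤ 1 := fun n ω => by
    simp only [hH, norm_mul, norm_pow, norm_neg, norm_one, one_pow, one_mul]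
    exact Real.abs_sin_le_one _
  have hD1 : ∀ ω, ‖D ω‖ = 1 := fun ω => by simp [hD]
  have hlim : ∀ᵐ ω ∂P, Tendsto (fun n => H n ω) atTop
      (𝓝 (pathSign (fun s => N s ω) s * Real.sin (w * pathTime (fun s => N s ω) s))) := by
    filter_upwards [h.ae_tendsto_gridTime s'] with ω hω
    have e : ∀ n, gridValues N s' n ω (Fin.last _) = N s' ω := fun n => by
      simp [gridValues, grid_gridSize]
    simp only [hH, e, pathSign]
    rw [randomTime_eq, es] at hω
    exact tendsto_const_nhds.mul ((Real.continuous_sin.tendsto _).comp (hω.const_mul w))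
  have hDmean : ∫ ω, D ω ∂P = Real.exp (-2 * a * (t - s)) := by
    have := (h.law_increment s' t' hst').integral_comp (f := fun n : ℕ => (-1 : ℝ) ^ n)
      Measurable.of_discrete.aestronglyMeasurable
    simp only [Function.comp_def] at this
    rw [hD, this, integral_neg_one_pow_poissonMeasure]
    congr 1
    rw [NNReal.coe_mul, NNReal.coe_sub hst', es, et, Real.coe_toNNReal a ha]
    ring
  have hprod : ∀ n, ∫ ω, H n ω * D ω ∂P = (∫ ω, H n ω ∂P) * Real.exp (-2 * a * (t - s)) := by
    intro n
    rw [← hDmean]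
    have hi := (h.indepFun_grid_increment hst' n).comp
      (φ := fun v : Fin (gridSize s' n + 1) → ℕ =>
        (-1 : ℝ) ^ v (Fin.last _) * Real.sin (w * gridTime s' n v))
      (ψ := fun n : ℕ => (-1 : ℝ) ^ n) Measurable.of_discrete Measurable.of_discrete
    exact hi.integral_fun_mul_eq_mul_integral (hHm n).aestronglyMeasurable
      hDm.aestronglyMeasurable
  have l1 : Tendsto (fun n => ∫ ω, H n ω * D ω ∂P) atTop
      (𝓝 (∫ ω, pathSign (fun s => N s ω) t * Real.sin (w * pathTime (fun s => N s ω) s) ∂P)) := by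
    refine tendsto_integral_of_dominated_convergence (fun _ => 1)
      (fun n => ((hHm n).mul hDm).aestronglyMeasurable) (integrable_const _)
      (fun n => ae_of_all _ fun ω => ?_) ?_
    · rw [norm_mul, hD1, mul_one]; exact hH1 n ω
    · filter_upwards [hlim, h.path_mono] with ω hω hmono
      have : pathSign (fun s => N s ω) t * Real.sin (w * pathTime (fun s => N s ω) s) =
          (pathSign (fun s => N s ω) s * Real.sin (w * pathTime (fun s => N s ω) s)) * D ω := by
        have e : pathSign (fun s => N s ω) t = pathSign (fun s => N s ω) s * D ω := by
          simp only [pathSign, hD]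
          rw [← pow_add, add_tsub_cancel_of_le (hmono hst')]
        rw [e]; ring
      rw [this]
      exact hω.mul_const _
  have l2 : Tendsto (fun n => (∫ ω, H n ω ∂P) * Real.exp (-2 * a * (t - s))) atTop
      (𝓝 (sinMean N P w s * Real.exp (-2 * a * (t - s)))) := by
    refine Tendsto.mul_const _ ?_
    exact tendsto_integral_of_dominated_convergence (fun _ => 1)
      (fun n => (hHm n).aestronglyMeasurable) (integrable_const _)
      (fun n => ae_of_all _ fun ω => hH1 n ω) hlim
  rw [tendsto_nhds_unique l1 (by simpa only [hprod] using l2), mul_comm]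

section Derivatives

variable [IsProbabilityMeasure P] (w : ℝ)

omit [IsProbabilityMeasure P] in
lemma aestronglyMeasurable_sin (h : IsPoissonProcess a N P) {s t : ℝ} (hs : 0 ≤ s) :
    AEStronglyMeasurable
      (fun ω => pathSign (fun s => N s ω) t * Real.sin (w * pathTime (fun s => N s ω) s)) P :=
  ((h.measurable_pathSign t).aemeasurable.mul
    (Real.measurable_sin.comp_aemeasurable
      ((h.aemeasurable_pathTime hs).const_mul w))).aestronglyMeasurable

lemma integrable_sin (h : IsPoissonProcess a N P) {s t : ℝ} (hs : 0 ≤ s) :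
    Integrable
      (fun ω => pathSign (fun s => N s ω) t * Real.sin (w * pathTime (fun s => N s ω) s)) P := by
  refine Integrable.of_bound (h.aestronglyMeasurable_sin w hs) 1 (ae_of_all _ fun ω => ?_)
  rw [norm_mul, Real.norm_eq_abs, abs_pathSign, one_mul]
  exact Real.abs_sin_le_one _

lemma integrable_cos (h : IsPoissonProcess a N P) {s : ℝ} (hs : 0 ≤ s) :
    Integrable (fun ω => Real.cos (w * pathTime (fun s => N s ω) s)) P :=
  Integrable.of_bound (Real.measurable_cos.comp_aemeasurable
      ((h.aemeasurable_pathTime hs).const_mul w)).aestronglyMeasurable 1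
    (ae_of_all _ fun _ => Real.abs_cos_le_one _)

omit [MeasurableSpace Ω] in
lemma abs_mul_pathTime_sub_le {ω : Ω} (hω : Monotone fun s => N s ω) (s t : ℝ) :
    |w * pathTime (fun s => N s ω) t - w * pathTime (fun s => N s ω) s| ≤ |w| * |t - s| := by
  rw [← mul_sub, abs_mul]
  exact mul_le_mul_of_nonneg_left (abs_pathTime_sub_le hω s t) (abs_nonneg w)

/-- The part of the increment of `sinMean` that comes from the change of the random time. -/
noncomputable def sinIncrement (N : ℝ≥0 → Ω → ℕ) (P : Measure Ω) (w s t : ℝ) : ℝ :=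
  ∫ ω, pathSign (fun s => N s ω) t * (Real.sin (w * pathTime (fun s => N s ω) t) -
    Real.sin (w * pathTime (fun s => N s ω) s)) ∂P

/-- The sign jumps, so the integrand of `sinMean` cannot be differentiated path by path.
Independence averages the jumps exactly into the exponential factor; the remaining part is Lipschitz
in time and can be differentiated under the integral. -/
lemma sinMean_eq (h : IsPoissonProcess a N P) (ha : 0 ≤ a) {s t : ℝ} (hs : 0 ≤ s) (hst : s ≤ t) :
    sinMean N P w t =
      sinIncrement N P w s t + Real.exp (-2 * a * (t - s)) * sinMean N P w s := by
  rw [← h.integral_pathSign_mul_sin ha w hs hst, sinIncrement]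
  simp only [mul_sub]
  rw [integral_sub (h.integrable_sin w (hs.trans hst)) (h.integrable_sin w hs), sub_add_cancel]
  rfl

lemma abs_sinIncrement_le (h : IsPoissonProcess a N P) (s t : ℝ) :
    |sinIncrement N P w s t| ≤ |w| * |t - s| := by
  have : ∀ᵐ ω ∂P, ‖pathSign (fun s => N s ω) t * (Real.sin (w * pathTime (fun s => N s ω) t) -
      Real.sin (w * pathTime (fun s => N s ω) s))‖ ≤ |w| * |t - s| := by
    filter_upwards [h.path_mono] with ω hω
    rw [norm_mul, Real.norm_eq_abs, abs_pathSign, one_mul]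
    exact (abs_sin_sub_sin_le _ _).trans (abs_mul_pathTime_sub_le w hω s t)
  simpa [sinIncrement] using norm_integral_le_of_norm_le_const this

lemma abs_sinMean_le_one (s : ℝ) : |sinMean N P w s| ≤ 1 := by
  have : ∀ᵐ ω ∂P, ‖pathSign (fun s => N s ω) s * Real.sin (w * pathTime (fun s => N s ω) s)‖ ≤
      1 := by
    refine ae_of_all _ fun ω => ?_
    rw [norm_mul, Real.norm_eq_abs, abs_pathSign, one_mul]
    exact Real.abs_sin_le_one _
  simpa [sinMean] using norm_integral_le_of_norm_le_const this

/-- Right derivatives give no left continuity, which `le_of_deriv_right_nonpos` requires; it comes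
from the Lipschitz bound on the occupation integral. -/
lemma continuousOn_cosMean (h : IsPoissonProcess a N P) :
    ContinuousOn (cosMean N P w) (Set.Ici 0) := by
  refine (LipschitzOnWith.of_dist_le_mul (K := ‖w‖₊) fun t ht s hs => ?_).continuousOn
  rw [Real.dist_eq, Real.dist_eq, cosMean, cosMean,
    ← integral_sub (h.integrable_cos w ht) (h.integrable_cos w hs)]
  have : ∀ᵐ ω ∂P, ‖Real.cos (w * pathTime (fun s => N s ω) t) -
      Real.cos (w * pathTime (fun s => N s ω) s)‖ ≤ |w| * |t - s| := by
    filter_upwards [h.path_mono] with ω hω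
    exact (abs_cos_sub_cos_le _ _).trans (abs_mul_pathTime_sub_le w hω s t)
  simpa using norm_integral_le_of_norm_le_const this

lemma abs_sinMean_sub_le (h : IsPoissonProcess a N P) (ha : 0 ≤ a) {s t : ℝ} (hs : 0 ≤ s)
    (hst : s ≤ t) : |sinMean N P w t - sinMean N P w s| ≤ (|w| + 2 * a) * |t - s| := by
  have h1 := abs_le.1 (h.abs_sinIncrement_le w s t)
  have h2 := abs_le.1 (abs_sinMean_le_one (N := N) (P := P) w s)
  have h3 := Real.add_one_le_exp (-2 * a * (t - s))
  have h4 : Real.exp (-2 * a * (t - s)) ≤ 1 := Real.exp_le_one_iff.2 (by nlinarith)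
  rw [abs_of_nonneg (sub_nonneg.2 hst)] at *
  rw [h.sinMean_eq w ha hs hst, abs_le]
  constructor <;> nlinarith

lemma continuousOn_sinMean (h : IsPoissonProcess a N P) (ha : 0 ≤ a) :
    ContinuousOn (sinMean N P w) (Set.Ici 0) := by
  refine (LipschitzOnWith.of_dist_le_mul (K := ‖w‖₊ + 2 * a.toNNReal) fun t ht s hs => ?_).continuousOn
  have e : ((‖w‖₊ + 2 * a.toNNReal : ℝ≥0) : ℝ) = |w| + 2 * a := by
    simp [Real.coe_toNNReal a ha]
  rw [Real.dist_eq, Real.dist_eq, e]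
  rcases le_total s t with hst | hst
  · exact h.abs_sinMean_sub_le w ha hs hst
  · rw [abs_sub_comm, abs_sub_comm t s]
    exact h.abs_sinMean_sub_le w ha ht hst

lemma hasDerivWithinAt_cosMean (h : IsPoissonProcess a N P) {t : ℝ} (ht : 0 ≤ t) :
    HasDerivWithinAt (cosMean N P w) (-w * sinMean N P w t) (Set.Ici t) t := by
  rw [← hasDerivWithinAt_Ioi_iff_Ici, hasDerivWithinAt_iff_tendsto_slope' Set.self_notMem_Ioi]
  have e : -w * sinMean N P w t = ∫ ω, -w * (pathSign (fun s => N s ω) t *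
      Real.sin (w * pathTime (fun s => N s ω) t)) ∂P := by
    rw [integral_const_mul]; rfl
  have e2 : ∀ᶠ y in 𝓝[>] t, ∫ ω, (y - t)⁻¹ * (Real.cos (w * pathTime (fun s => N s ω) y) -
      Real.cos (w * pathTime (fun s => N s ω) t)) ∂P = slope (cosMean N P w) t y := by
    filter_upwards [self_mem_nhdsWithin] with y hy
    rw [integral_const_mul, integral_sub (h.integrable_cos w (ht.trans (le_of_lt hy)))
      (h.integrable_cos w ht), slope_def_field, div_eq_inv_mul]
    rfl
  rw [e]
  refine Tendsto.congr' e2 ?_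
  refine tendsto_integral_filter_of_dominated_convergence (fun _ => |w|) ?_ ?_
    (integrable_const _) ?_
  · filter_upwards [self_mem_nhdsWithin] with y hy
    exact (((h.integrable_cos w (ht.trans (le_of_lt hy))).sub
      (h.integrable_cos w ht)).const_mul _).aestronglyMeasurable
  · filter_upwards [self_mem_nhdsWithin] with y hy
    filter_upwards [h.path_mono] with ω hω
    have hy' : 0 < y - t := sub_pos.2 hy
    have hb := (abs_cos_sub_cos_le _ _).trans (abs_mul_pathTime_sub_le w hω t y)
    rw [norm_mul, norm_inv, Real.norm_eq_abs, Real.norm_eq_abs, inv_mul_le_iff₀ (abs_pos.2 hy'.ne')]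
    linarith
  · filter_upwards [h.path_mono, h.path_rightCont] with ω hω hc
    have hd := ((hasDerivWithinAt_pathTime hω hc t).const_mul w).cos
    rw [← hasDerivWithinAt_Ioi_iff_Ici, hasDerivWithinAt_iff_tendsto_slope' Set.self_notMem_Ioi]
      at hd
    convert! hd using 2
    ring

/-- The difference quotient of the sine tends to w(-1)^{N(t)} cos(w τ_t), and the sign in front
tends to (-1)^{N(t)} by right continuity. The two signs multiply to 1, and |w| dominates. -/
lemma hasDerivWithinAt_sinIncrement (h : IsPoissonProcess a N P) {t : ℝ} (ht : 0 ≤ t) :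
    HasDerivWithinAt (sinIncrement N P w t) (w * cosMean N P w t) (Set.Ici t) t := by
  rw [← hasDerivWithinAt_Ioi_iff_Ici, hasDerivWithinAt_iff_tendsto_slope' Set.self_notMem_Ioi]
  have e : w * cosMean N P w t = ∫ ω, w * Real.cos (w * pathTime (fun s => N s ω) t) ∂P := by
    rw [integral_const_mul]; rfl
  have e2 : ∀ y, ∫ ω, (y - t)⁻¹ * (pathSign (fun s => N s ω) y *
      (Real.sin (w * pathTime (fun s => N s ω) y) -
        Real.sin (w * pathTime (fun s => N s ω) t))) ∂P = slope (sinIncrement N P w t) t y := by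
    intro y
    rw [integral_const_mul, slope_def_field, div_eq_inv_mul]
    simp [sinIncrement]
  simp_rw [← funext e2, e]
  refine tendsto_integral_filter_of_dominated_convergence (fun _ => |w|) ?_ ?_
    (integrable_const _) ?_
  · filter_upwards [self_mem_nhdsWithin] with y hy
    simp only [mul_sub (pathSign _ _)]
    exact (((h.integrable_sin w (ht.trans (le_of_lt hy))).sub
      (h.integrable_sin w ht)).const_mul _).aestronglyMeasurable
  · filter_upwards [self_mem_nhdsWithin] with y hy
    filter_upwards [h.path_mono] with ω hω
    have hy' : 0 < y - t := sub_pos.2 hy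
    have hb := (abs_sin_sub_sin_le _ _).trans (abs_mul_pathTime_sub_le w hω t y)
    rw [norm_mul, norm_mul, norm_inv, Real.norm_eq_abs, Real.norm_eq_abs, Real.norm_eq_abs,
      abs_pathSign, one_mul, inv_mul_le_iff₀ (abs_pos.2 hy'.ne')]
    linarith
  · filter_upwards [h.path_mono, h.path_rightCont] with ω hω hc
    have hd := ((hasDerivWithinAt_pathTime hω hc t).const_mul w).sin
    rw [← hasDerivWithinAt_Ioi_iff_Ici, hasDerivWithinAt_iff_tendsto_slope' Set.self_notMem_Ioi]
      at hd
    have hs := ((continuousWithinAt_pathSign hc t).mono Set.Ioi_subset_Ici_self).tendsto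
    convert! hs.mul hd using 2
    · rw [slope_def_field, div_eq_inv_mul]; ring
    · linear_combination (-w * Real.cos (w * pathTime (fun s => N s ω) t)) *
        pathSign_mul_self (fun s => N s ω) t

lemma hasDerivWithinAt_sinMean (h : IsPoissonProcess a N P) (ha : 0 ≤ a) {t : ℝ} (ht : 0 ≤ t) :
    HasDerivWithinAt (sinMean N P w) (w * cosMean N P w t - 2 * a * sinMean N P w t)
      (Set.Ici t) t := by
  have h1 : HasDerivAt (fun y => Real.exp (-2 * a * (y - t)) * sinMean N P w t)
      (-2 * a * sinMean N P w t) t := by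
    have := ((((hasDerivAt_id t).sub_const t).const_mul (-2 * a)).exp).mul_const (sinMean N P w t)
    simpa using this
  have h2 := (h.hasDerivWithinAt_sinIncrement w ht).add h1.hasDerivWithinAt
  refine (h2.congr_of_mem (fun y hy => h.sinMean_eq w ha ht hy) Set.self_mem_Ici).congr_deriv ?_
  ring

/-- The trigonometric means of the random time solve the telegraph equation. -/
theorem isTelegraphSolution (h : IsPoissonProcess a N P) (ha : 0 ≤ a) :
    IsTelegraphSolution a w (cosMean N P w) (sinMean N P w) where
  contP := h.continuousOn_cosMean w
  contQ := h.continuousOn_sinMean w ha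
  derivP _ ht := h.hasDerivWithinAt_cosMean w ht
  derivQ _ ht := h.hasDerivWithinAt_sinMean w ha ht
  initP := by simp [cosMean, pathTime_zero]
  initQ := by simp [sinMean, pathTime_zero]

end Derivatives

end IsPoissonProcess

/-! ### The characteristic function of the Kac process -/

lemma integral_signLaw (f : ℝ → ℝ) : ∫ x, f x ∂signLaw = (f 1 + f (-1)) / 2 := by
  rw [signLaw, integral_add_measure, integral_smul_measure, integral_smul_measure]
  · simp; ring
  all_goals exact (integrable_dirac (by simp)).smul_measure (by simp)

namespace IsKacProcess

variable {c : ℝ} {K : ℝ≥0 → Ω → ℝ}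

lemma aemeasurable (h : IsKacProcess a c K P) (t : ℝ≥0) : AEMeasurable (K t) P := by
  obtain ⟨N, B, hN, hB, -, -, hK⟩ := h
  rw [funext (hK t)]
  exact hB.aemeasurable.mul ((hN.aemeasurable_randomTime t).const_mul c)

/-- The characteristic function of a Kac process is real and solves the telegraph equation in
time. -/
lemma exists_charFun_eq [IsProbabilityMeasure P] (ha : 0 ≤ a) (h : IsKacProcess a c K P) (ξ : ℝ) :
    ∃ p q : ℝ → ℝ, IsTelegraphSolution a (c * ξ) p q ∧
      ∀ t : ℝ≥0, charFun (P.map (K t)) ξ = p t := by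
  have hKm := h.aemeasurable
  obtain ⟨N, B, hN, hB, hBl, hBN, hK⟩ := h
  refine ⟨_, _, hN.isTelegraphSolution (c * ξ) ha, fun t => ?_⟩
  have hB1 : ∀ᵐ ω ∂P, B ω = 1 ∨ B ω = -1 := by
    rw [hBl.ae_iff (p := fun x => x = 1 ∨ x = -1)
      ((measurableSet_eq.union measurableSet_eq).mem), signLaw]
    simp [ae_iff]
  have hBmean : ∫ ω, B ω ∂P = 0 := by
    rw [hBl.integral_eq, integral_signLaw]; simp
  have hs : ∫ ω, B ω * Real.sin (c * ξ * randomTime N t ω) ∂P = 0 := by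
    -- Independence of B is given for the product σ-algebra on paths, where finitely many
    -- coordinates are measurable; τ_t is reached as the limit of its grid sums.
    have l1 : Tendsto (fun n => ∫ ω, B ω * Real.sin (c * ξ * gridTime t n (gridValues N t n ω)) ∂P)
        atTop (𝓝 (∫ ω, B ω * Real.sin (c * ξ * randomTime N t ω) ∂P)) := by
      refine tendsto_integral_of_dominated_convergence (fun _ => 1)
        (fun n => (hB.mul (Real.measurable_sin.comp
          ((hN.measurable_gridTime t n).const_mul _))).aestronglyMeasurable) (integrable_const _)
        (fun n => ?_) ?_
      · filter_upwards [hB1] with ω hω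
        rw [norm_mul]
        have : ‖B ω‖ = 1 := by rcases hω with h | h <;> simp [h]
        rw [this, one_mul]
        exact Real.abs_sin_le_one _
      · filter_upwards [hN.ae_tendsto_gridTime t] with ω hω
        exact tendsto_const_nhds.mul ((Real.continuous_sin.tendsto _).comp (hω.const_mul _))
    have l2 : ∀ n, ∫ ω, B ω * Real.sin (c * ξ * gridTime t n (gridValues N t n ω)) ∂P = 0 := by
      intro n
      have hg : Measurable fun v : ℝ≥0 → ℕ => fun k : Fin (gridSize t n + 1) => v (grid t n k) :=
        measurable_pi_lambda _ fun _ => measurable_pi_apply _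
      have hi := hBN.comp (φ := id)
        (ψ := fun v => Real.sin (c * ξ * gridTime t n fun k => v (grid t n k))) measurable_id
        ((Measurable.of_discrete (f := fun v => Real.sin (c * ξ * gridTime t n v))).comp hg)
      have := hi.integral_fun_mul_eq_mul_integral hB.aestronglyMeasurable
        (Real.measurable_sin.comp ((hN.measurable_gridTime t n).const_mul _)).aestronglyMeasurable
      refine this.trans ?_
      simp [hBmean]
    exact tendsto_nhds_unique l1 (by simp [l2])
  rw [charFun_apply_real, integral_map (hKm t) (by fun_prop)]
  -- For B = ±1, evenness of cos and oddness of sin pull the sign out of the arguments.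
  have hpt : ∀ᵐ ω ∂P, Complex.exp (ξ * K t ω * Complex.I) =
      ((Real.cos (c * ξ * randomTime N t ω) : ℝ) : ℂ) +
        ((B ω * Real.sin (c * ξ * randomTime N t ω) : ℝ) : ℂ) * Complex.I := by
    filter_upwards [hB1] with ω hω
    have e : ξ * K t ω = B ω * (c * ξ * randomTime N t ω) := by rw [hK]; ring
    rw [← Complex.ofReal_mul, Complex.exp_mul_I, ← Complex.ofReal_cos, ← Complex.ofReal_sin, e]
    rcases hω with h | h <;> simp [h]
  have hsm : AEMeasurable (fun ω => B ω * Real.sin (c * ξ * randomTime N t ω)) P :=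
    hB.aemeasurable.mul (Real.measurable_sin.comp_aemeasurable
      ((hN.aemeasurable_randomTime t).const_mul _))
  have hsi : Integrable (fun ω => B ω * Real.sin (c * ξ * randomTime N t ω)) P := by
    refine Integrable.of_bound hsm.aestronglyMeasurable 1 ?_
    filter_upwards [hB1] with ω hω
    rw [norm_mul]
    have : ‖B ω‖ = 1 := by rcases hω with h | h <;> simp [h]
    rw [this, one_mul]
    exact Real.abs_sin_le_one _
  rw [integral_congr_ae hpt, integral_add, integral_mul_const, integral_complex_ofReal,
    integral_complex_ofReal, hs]
  · simp [cosMean, randomTime_eq]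
  · exact (hN.integrable_cos (c * ξ) (NNReal.coe_nonneg t)).ofReal
  · exact hsi.ofReal.mul_const _

end IsKacProcess

end

/-! ### Plancherel for the Fourier integral -/

section Plancherel

open scoped FourierTransform SchwartzMap

lemma ae_eq_of_integral_schwartz_smul_eq {f g : ℝ → ℂ} (hf : LocallyIntegrable f volume)
    (hg : LocallyIntegrable g volume)
    (h : ∀ φ : 𝓢(ℝ, ℂ), ∫ x, φ x • f x = ∫ x, φ x • g x) : f =ᵐ[volume] g := by
  refine ae_eq_of_integral_contDiff_smul_eq hf hg fun φ hφ hc => ?_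
  have h1 : HasCompactSupport (Complex.ofRealCLM ∘ φ) := hc.comp_left rfl
  have h2 : ContDiff ℝ ((⊤ : ℕ∞) : WithTop ℕ∞) (Complex.ofRealCLM ∘ φ) := by fun_prop
  have := h (h1.toSchwartzMap h2)
  simpa using this

lemma integral_schwartz_smul_fourier (φ : 𝓢(ℝ, ℂ)) {f : ℝ → ℂ} (hf : Integrable f) :
    ∫ x, φ x • 𝓕 f x = ∫ x, (𝓕 φ) x • f x := by
  have := VectorFourier.integral_fourierIntegral_smul_eq_flip (L := innerₗ ℝ) (μ := volume)
    (ν := volume) Real.continuous_fourierChar continuous_inner φ.integrable hf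
  simpa using! this.symm

lemma continuous_fourier_of_integrable {f : ℝ → ℂ} (hf : Integrable f) : Continuous (𝓕 f) :=
  VectorFourier.fourierIntegral_continuous Real.continuous_fourierChar
    (by exact continuous_inner) hf

/-- Plancherel's theorem for the Fourier integral on `L¹ ∩ L²`. -/
theorem memLp_fourier {f : ℝ → ℂ} (hf : Integrable f) (hf2 : MemLp f 2) :
    MemLp (𝓕 f) 2 ∧ eLpNorm (𝓕 f) 2 = eLpNorm f 2 := by
  -- The isometric transform on L² agrees with the Fourier integral because both define the same
  -- tempered distribution.
  set g : Lp ℂ 2 (volume : Measure ℝ) := 𝓕 (hf2.toLp f) with hg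
  have hae : 𝓕 f =ᵐ[volume] g := by
    refine ae_eq_of_integral_schwartz_smul_eq
      (continuous_fourier_of_integrable hf).locallyIntegrable
      ((Lp.memLp g).locallyIntegrable (by norm_num)) fun φ => ?_
    have h1 := DFunLike.congr_fun (Lp.fourier_toTemperedDistribution_eq (hf2.toLp f)) φ
    rw [TemperedDistribution.fourier_apply, Lp.toTemperedDistribution_apply,
      Lp.toTemperedDistribution_apply] at h1
    rw [integral_schwartz_smul_fourier φ hf, ← h1]
    refine integral_congr_ae ?_
    filter_upwards [hf2.coeFn_toLp] with x hx
    rw [hx]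
  refine ⟨(memLp_congr_ae hae).2 (Lp.memLp g), ?_⟩
  rw [eLpNorm_congr_ae hae, ← Lp.enorm_def, ← eLpNorm_congr_ae hf2.coeFn_toLp, ← Lp.enorm_def, hg,
    enorm_eq_iff_norm_eq, Lp.norm_fourier_eq]

/-- An integrable function whose Fourier integral is square-integrable is itself
square-integrable. -/
theorem memLp_of_fourier {f : ℝ → ℂ} (hf : Integrable f) (hf2 : MemLp (𝓕 f) 2) :
    MemLp f 2 ∧ eLpNorm f 2 = eLpNorm (𝓕 f) 2 := by
  set G : Lp ℂ 2 (volume : Measure ℝ) := hf2.toLp (𝓕 f) with hG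
  -- The candidate is the L² inverse transform of the Fourier integral of f. Testing against ψ =
  -- 𝓕(𝓕⁻ψ) identifies it with f.
  set g : Lp ℂ 2 (volume : Measure ℝ) := 𝓕⁻ G with hg
  have hgG : 𝓕 g = G := FourierTransform.fourier_fourierInv_eq G
  have hae : f =ᵐ[volume] g := by
    refine ae_eq_of_integral_schwartz_smul_eq hf.locallyIntegrable
      ((Lp.memLp g).locallyIntegrable (by norm_num)) fun ψ => ?_
    have h1 := DFunLike.congr_fun (Lp.fourier_toTemperedDistribution_eq g) (𝓕⁻ ψ)
    rw [TemperedDistribution.fourier_apply, Lp.toTemperedDistribution_apply,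
      Lp.toTemperedDistribution_apply, hgG, FourierTransform.fourier_fourierInv_eq] at h1
    rw [h1]
    have h2 := integral_schwartz_smul_fourier (𝓕⁻ ψ) hf
    rw [FourierTransform.fourier_fourierInv_eq] at h2
    rw [← h2]
    refine integral_congr_ae ?_
    filter_upwards [hf2.coeFn_toLp] with x hx
    rw [hx]
  refine ⟨(memLp_congr_ae hae).2 (Lp.memLp g), ?_⟩
  rw [eLpNorm_congr_ae hae, ← Lp.enorm_def, ← eLpNorm_congr_ae hf2.coeFn_toLp, ← Lp.enorm_def,
    ← hG, ← hgG, enorm_eq_iff_norm_eq, Lp.norm_fourier_eq]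

lemma eLpNorm_gaussian {b : ℝ} (hb : 0 < b) :
    MemLp (fun x : ℝ => Real.exp (-b * x ^ 2)) 2 ∧
    eLpNorm (fun x : ℝ => Real.exp (-b * x ^ 2)) 2 =
      ENNReal.ofReal ((Real.pi / (2 * b)) ^ (1 / 4 : ℝ)) := by
  have e : ∀ x : ℝ, Real.exp (-b * x ^ 2) ^ 2 = Real.exp (-(2 * b) * x ^ 2) := fun x => by
    rw [← Real.exp_nat_mul]; congr 1; push_cast; ring
  have hm : MemLp (fun x : ℝ => Real.exp (-b * x ^ 2)) 2 := by
    refine (memLp_two_iff_integrable_sq (by fun_prop)).2 ?_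
    simpa only [e] using integrable_exp_neg_mul_sq (b := 2 * b) (by positivity)
  refine ⟨hm, ?_⟩
  rw [hm.eLpNorm_eq_integral_rpow_norm two_ne_zero ENNReal.ofNat_ne_top]
  have e2 : ∀ x : ℝ, ‖Real.exp (-b * x ^ 2)‖ ^ (2 : ℝ≥0∞).toReal = Real.exp (-(2 * b) * x ^ 2) :=
    fun x => by
      rw [Real.norm_of_nonneg (Real.exp_pos _).le, ENNReal.toReal_ofNat, Real.rpow_ofNat, e]
  simp only [e2]
  rw [integral_gaussian, Real.sqrt_eq_rpow, ← Real.rpow_mul (by positivity)]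
  norm_num

/-- An `L²` estimate through a pointwise bound on the Fourier side by a Gaussian and a multiple of
another Fourier transform. -/
theorem eLpNorm_le_of_norm_fourier_le {v f : ℝ → ℂ} (hv : Integrable v) (hf : Integrable f)
    (hf2 : MemLp f 2) {A B b : ℝ} (hA : 0 ≤ A) (hB : 0 ≤ B) (hb : 0 < b)
    (h : ∀ x, ‖𝓕 v x‖ ≤ A * Real.exp (-b * x ^ 2) + B * ‖𝓕 f x‖) :
    eLpNorm v 2 ≤ ENNReal.ofReal (A * (Real.pi / (2 * b)) ^ (1 / 4 : ℝ)) +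
      ENNReal.ofReal B * eLpNorm f 2 := by
  obtain ⟨hg, hg2⟩ := eLpNorm_gaussian hb
  obtain ⟨hF, hF2⟩ := memLp_fourier hf hf2
  obtain ⟨G, hG⟩ : ∃ G : ℝ → ℝ, G = fun x => Real.exp (-b * x ^ 2) := ⟨_, rfl⟩
  have hGx : ∀ x, Real.exp (-b * x ^ 2) = G x := fun x => by rw [hG]
  rw [← hG] at hg hg2
  simp only [hGx] at h
  obtain ⟨H, hH⟩ : ∃ H : ℝ → ℝ, H = fun x => ‖𝓕 f x‖ := ⟨_, rfl⟩
  have hHx : ∀ x, ‖𝓕 f x‖ = H x := fun x => by rw [hH]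
  have hHm : MemLp H 2 := hH ▸ hF.norm
  simp only [hHx] at h
  have m1 : MemLp (A • G) 2 := hg.const_smul A
  have m2 : MemLp (B • H) 2 := hHm.const_smul B
  have hle : ∀ x, ‖𝓕 v x‖ ≤ ‖(A • G + B • H) x‖ := fun x => by
    rw [Pi.add_apply, Pi.smul_apply, Pi.smul_apply, smul_eq_mul, smul_eq_mul]
    exact (h x).trans (Real.le_norm_self _)
  have hvm : MemLp (𝓕 v) 2 := (m1.add m2).mono
    (continuous_fourier_of_integrable hv).aestronglyMeasurable (ae_of_all _ hle)
  have hHn : eLpNorm H 2 = eLpNorm f 2 := by rw [hH, eLpNorm_norm, hF2]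
  have e1 : eLpNorm (A • G) 2 = ENNReal.ofReal (A * (Real.pi / (2 * b)) ^ (1 / 4 : ℝ)) := by
    rw [eLpNorm_const_smul, hg2, Real.enorm_of_nonneg hA, ENNReal.ofReal_mul hA]
  have e2 : eLpNorm (B • H) 2 = ENNReal.ofReal B * eLpNorm f 2 := by
    rw [eLpNorm_const_smul, hHn, Real.enorm_of_nonneg hB]
  rw [(memLp_of_fourier hv hvm).2, ← e1, ← e2]
  exact (eLpNorm_mono hle).trans
    (eLpNorm_add_le m1.aestronglyMeasurable m2.aestronglyMeasurable (by norm_num))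

end Plancherel

/-! ### L² bounds for convolution densities from characteristic functions -/

section Density

open scoped FourierTransform

/-- The real-valued Lebesgue density of a measure. -/
noncomputable def dens (m : Measure ℝ) (x : ℝ) : ℝ := (m.rnDeriv volume x).toReal

variable {μ ν ν₁ ν₂ : Measure ℝ} [IsProbabilityMeasure μ] [IsProbabilityMeasure ν]
  [IsProbabilityMeasure ν₁] [IsProbabilityMeasure ν₂]

lemma integrable_dens : Integrable (dens μ) := Measure.integrable_toReal_rnDeriv

lemma measurable_dens (m : Measure ℝ) : Measurable (dens m) :=
  (Measure.measurable_rnDeriv _ _).ennreal_toReal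

lemma fourier_dens (hμ : μ ≪ volume) (x : ℝ) :
    𝓕 (fun y => (dens μ y : ℂ)) x = charFun μ (-2 * Real.pi * x) := by
  rw [Real.fourier_eq', charFun_apply_real, ← integral_rnDeriv_smul hμ]
  refine integral_congr_ae (ae_of_all _ fun y => ?_)
  simp only [dens, smul_eq_mul, Real.inner_apply, Complex.real_smul]
  rw [mul_comm]
  congr 3
  push_cast
  ring

lemma conv_ac (hμ : μ ≪ volume) (ν : Measure ℝ) [IsProbabilityMeasure ν] :
    μ ∗ ν ≪ volume := by
  rw [Measure.conv_comm]
  exact Measure.conv_absolutelyContinuous hμ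

lemma fourier_dens_conv (hμ : μ ≪ volume) (x : ℝ) :
    𝓕 (fun y => (dens (μ ∗ ν) y : ℂ)) x =
      𝓕 (fun y => (dens μ y : ℂ)) x * charFun ν (-2 * Real.pi * x) := by
  rw [fourier_dens (conv_ac hμ ν), fourier_dens hμ, charFun_conv]

lemma norm_fourier_dens_le_one (hμ : μ ≪ volume) (x : ℝ) :
    ‖𝓕 (fun y => (dens μ y : ℂ)) x‖ ≤ 1 := by
  rw [fourier_dens hμ]; exact norm_charFun_le_one _

lemma eLpNorm_ofReal_comp (f : ℝ → ℝ) :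
    eLpNorm (fun x => (f x : ℂ)) 2 = eLpNorm f 2 :=
  eLpNorm_congr_norm_ae (ae_of_all _ fun x => by simp)

/-- Gaussian-type bounds for the characteristic function give `L²` bounds for the density of a
convolution. -/
theorem eLpNorm_dens_conv_le (hμ : μ ≪ volume) (hμ2 : MemLp (dens μ) 2) {A B b : ℝ} (hA : 0 ≤ A)
    (hB : 0 ≤ B) (hb : 0 < b)
    (h : ∀ ξ, ‖charFun ν ξ‖ ≤ A * Real.exp (-(b * ξ ^ 2)) + B) :
    eLpNorm (dens (μ ∗ ν)) 2 ≤ ENNReal.ofReal (A * (8 * Real.pi * b)⁻¹ ^ (1 / 4 : ℝ)) +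
      ENNReal.ofReal B * eLpNorm (dens μ) 2 := by
  have := eLpNorm_le_of_norm_fourier_le (v := fun x => (dens (μ ∗ ν) x : ℂ))
    (f := fun x => (dens μ x : ℂ)) (integrable_dens (μ := μ ∗ ν)).ofReal
    (integrable_dens (μ := μ)).ofReal hμ2.ofReal hA hB (b := 4 * Real.pi ^ 2 * b) (by positivity)
    -- The transform of the density of μ is estimated by 1 in the Gaussian term but kept in the term
    -- B, since a constant alone is not square-integrable. The substitution ξ = -2πx turns b into
    -- 4π²b.
    (fun x => by
      rw [fourier_dens_conv hμ, norm_mul]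
      have h1 := h (-2 * Real.pi * x)
      have h2 := norm_fourier_dens_le_one hμ x
      have e : -(b * (-2 * Real.pi * x) ^ 2) = -(4 * Real.pi ^ 2 * b) * x ^ 2 := by ring
      rw [e] at h1
      have h3 := mul_le_mul_of_nonneg_left h1 (norm_nonneg (𝓕 (fun y => (dens μ y : ℂ)) x))
      have h4 : 0 ≤ A * Real.exp (-(4 * Real.pi ^ 2 * b) * x ^ 2) := by positivity
      nlinarith)
  rw [eLpNorm_ofReal_comp, eLpNorm_ofReal_comp] at this
  have e : Real.pi / (2 * (4 * Real.pi ^ 2 * b)) = (8 * Real.pi * b)⁻¹ := by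
    field_simp
    norm_num
  rwa [e] at this

/-- Gaussian-type bounds for the difference of two characteristic functions give `L²` bounds for
the difference of the densities of the convolutions. -/
theorem eLpNorm_dens_conv_sub_le (hμ : μ ≪ volume) (hμ2 : MemLp (dens μ) 2) {A B b : ℝ}
    (hA : 0 ≤ A) (hB : 0 ≤ B) (hb : 0 < b)
    (h : ∀ ξ, ‖charFun ν₁ ξ - charFun ν₂ ξ‖ ≤ A * Real.exp (-(b * ξ ^ 2)) + B) :
    eLpNorm (fun x => dens (μ ∗ ν₁) x - dens (μ ∗ ν₂) x) 2 ≤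
      ENNReal.ofReal (A * (8 * Real.pi * b)⁻¹ ^ (1 / 4 : ℝ)) +
      ENNReal.ofReal B * eLpNorm (dens μ) 2 := by
  have i1 := (integrable_dens (μ := μ ∗ ν₁)).ofReal (𝕜 := ℂ)
  have i2 := (integrable_dens (μ := μ ∗ ν₂)).ofReal (𝕜 := ℂ)
  have := eLpNorm_le_of_norm_fourier_le
    (v := fun x => ((dens (μ ∗ ν₁) x - dens (μ ∗ ν₂) x : ℝ) : ℂ))
    (f := fun x => (dens μ x : ℂ))
    ((integrable_dens (μ := μ ∗ ν₁)).sub (integrable_dens (μ := μ ∗ ν₂))).ofReal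
    (integrable_dens (μ := μ)).ofReal hμ2.ofReal hA hB (b := 4 * Real.pi ^ 2 * b) (by positivity)
    (fun x => by
      have e0 : 𝓕 (fun x => ((dens (μ ∗ ν₁) x - dens (μ ∗ ν₂) x : ℝ) : ℂ)) x =
          𝓕 (fun x => (dens (μ ∗ ν₁) x : ℂ)) x - 𝓕 (fun x => (dens (μ ∗ ν₂) x : ℂ)) x := by
        simp only [Real.fourier_eq, Complex.ofReal_sub, smul_sub]
        exact integral_sub ((Real.fourierIntegral_convergent_iff x).2 i1)
          ((Real.fourierIntegral_convergent_iff x).2 i2)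
      rw [e0, fourier_dens_conv hμ, fourier_dens_conv hμ, ← mul_sub, norm_mul]
      have h1 := h (-2 * Real.pi * x)
      have h2 := norm_fourier_dens_le_one hμ x
      have e : -(b * (-2 * Real.pi * x) ^ 2) = -(4 * Real.pi ^ 2 * b) * x ^ 2 := by ring
      rw [e] at h1
      have h3 := mul_le_mul_of_nonneg_left h1 (norm_nonneg (𝓕 (fun y => (dens μ y : ℂ)) x))
      have h4 : 0 ≤ A * Real.exp (-(4 * Real.pi ^ 2 * b) * x ^ 2) := by positivity
      nlinarith)
  rw [eLpNorm_ofReal_comp fun x => dens (μ ∗ ν₁) x - dens (μ ∗ ν₂) x,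
    eLpNorm_ofReal_comp] at this
  have e : Real.pi / (2 * (4 * Real.pi ^ 2 * b)) = (8 * Real.pi * b)⁻¹ := by
    field_simp
    norm_num
  rwa [e] at this

end Density

/-! ### Product densities -/

section Product

lemma lintegral_fin_prod_eq_prod {n : ℕ} {α : Type*} [MeasurableSpace α]
    {μ : Fin n → Measure α} [∀ i, SigmaFinite (μ i)] {f : Fin n → α → ℝ≥0∞}
    (hf : ∀ i, Measurable (f i)) :
    ∫⁻ x : Fin n → α, ∏ i, f i (x i) ∂(Measure.pi μ) = ∏ i, ∫⁻ x, f i x ∂(μ i) := by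
  induction n with
  | zero => simp
  | succ n ih =>
    have hm : Measurable fun x : Fin (n + 1) → α => ∏ i, f i (x i) :=
      Finset.measurable_prod _ fun i _ => (hf i).comp (measurable_pi_apply i)
    have hm' : Measurable fun x : Fin n → α => ∏ i, f i.succ (x i) :=
      Finset.measurable_prod _ fun i _ => (hf i.succ).comp (measurable_pi_apply i)
    have h := ((measurePreserving_piFinSuccAbove μ 0).symm).lintegral_comp hm
    rw [← h, Fin.prod_univ_succ, ← ih fun i => hf i.succ,
      ← lintegral_prod_mul (hf 0).aemeasurable hm'.aemeasurable]
    refine lintegral_congr fun x => ?_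
    rw [Fin.prod_univ_succ]
    rfl

variable {d : ℕ}

lemma pi_conv_pi (μ ν : Fin d → Measure ℝ) [∀ i, IsProbabilityMeasure (μ i)]
    [∀ i, IsProbabilityMeasure (ν i)] :
    Measure.pi μ ∗ Measure.pi ν = Measure.pi fun i => μ i ∗ ν i := by
  have h := measurePreserving_arrowProdEquivProdArrow ℝ ℝ (Fin d) μ ν
  have : ∀ i, IsProbabilityMeasure (((μ i).prod (ν i)).map fun x : ℝ × ℝ => x.1 + x.2) :=
    fun i => Measure.isProbabilityMeasure_map (by fun_prop)
  have h2 := Measure.pi_map_pi (μ := fun i => (μ i).prod (ν i))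
    (f := fun _ (x : ℝ × ℝ) => x.1 + x.2) fun i => by fun_prop
  simp only [Measure.conv]
  rw [← h2, ← h.map_eq, Measure.map_map (by fun_prop) h.measurable]
  rfl

lemma pi_eq_withDensity (m : Fin d → Measure ℝ) [∀ i, IsProbabilityMeasure (m i)]
    (hm : ∀ i, m i ≪ volume) :
    Measure.pi m = (volume : Measure (Fin d → ℝ)).withDensity
      fun x => ∏ i, (m i).rnDeriv volume (x i) := by
  refine Measure.pi_eq fun s hs => ?_
  rw [withDensity_apply _ (MeasurableSet.univ_pi hs), volume_pi, Measure.restrict_pi_pi,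
    lintegral_fin_prod_eq_prod fun i => Measure.measurable_rnDeriv _ _]
  refine Finset.prod_congr rfl fun i _ => ?_
  rw [Measure.setLIntegral_rnDeriv (hm i)]

lemma eLpNorm_prod {g : Fin d → ℝ → ℝ} (hg : ∀ i, Measurable (g i)) :
    eLpNorm (fun x : Fin d → ℝ => ∏ i, g i (x i)) 2 volume = ∏ i, eLpNorm (g i) 2 volume := by
  simp only [eLpNorm_eq_lintegral_rpow_enorm_toReal two_ne_zero ENNReal.ofNat_ne_top]
  rw [ENNReal.prod_rpow_of_nonneg (by positivity), volume_pi,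
    ← lintegral_fin_prod_eq_prod fun i => (hg i).enorm.pow_const _]
  congr 2
  ext x
  rw [ENNReal.prod_rpow_of_nonneg (by positivity)]
  congr 1
  simp only [enorm_eq_nnnorm, nnnorm_prod, ENNReal.ofNNReal_finsetProd]

/-- Telescoping estimate for the `L²` distance of two product functions. -/
theorem eLpNorm_prod_sub_prod_le {u h : Fin d → ℝ → ℝ} (hu : ∀ i, Measurable (u i))
    (hh : ∀ i, Measurable (h i)) {M δ : ℝ≥0∞} (huM : ∀ i, eLpNorm (u i) 2 volume ≤ M)
    (hhM : ∀ i, eLpNorm (h i) 2 volume ≤ M)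
    (hd : ∀ i, eLpNorm (fun x => u i x - h i x) 2 volume ≤ δ) :
    eLpNorm (fun x : Fin d → ℝ => ∏ i, u i (x i) - ∏ i, h i (x i)) 2 volume ≤
      d * (M ^ (d - 1) * δ) := by
  classical
  -- Hybrid products, with u on S and h elsewhere. Enlarging S by a alters one factor, so that step
  -- is again a product, with u a - h a in slot a.
  set G : Finset (Fin d) → (Fin d → ℝ) → ℝ :=
    fun S x => ∏ i, (if i ∈ S then u i else h i) (x i) with hG
  have hmeas : ∀ S : Finset (Fin d), ∀ i, Measurable (if i ∈ S then u i else h i) := by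
    intro S i; split_ifs; exacts [hu i, hh i]
  have hGm : ∀ S, Measurable (G S) := fun S =>
    Finset.measurable_prod _ fun i _ => (hmeas S i).comp (measurable_pi_apply i)
  have key : ∀ S : Finset (Fin d), eLpNorm (fun x => G S x - G ∅ x) 2 volume ≤
      S.card * (M ^ (d - 1) * δ) := by
    intro S
    induction S using Finset.induction_on with
    | empty => simp
    | insert a S ha ih =>
      have e : (fun x => G (insert a S) x - G ∅ x) =
          (fun x : Fin d → ℝ => ∏ i, (if i = a then fun y => u a y - h a y else
            if i ∈ S then u i else h i) (x i)) + fun x => G S x - G ∅ x := by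
        funext x
        have h1 : ∀ g : Fin d → ℝ → ℝ, ∏ i, g i (x i) =
            g a (x a) * ∏ i ∈ Finset.univ.erase a, g i (x i) := fun g =>
          (Finset.mul_prod_erase _ _ (Finset.mem_univ a)).symm
        have h2 : ∀ g : Fin d → ℝ → ℝ, (∀ i ≠ a, g i = if i ∈ S then u i else h i) →
            ∏ i ∈ Finset.univ.erase a, g i (x i) =
              ∏ i ∈ Finset.univ.erase a, (if i ∈ S then u i else h i) (x i) := fun g hg =>
          Finset.prod_congr rfl fun i hi => by rw [hg i (Finset.ne_of_mem_erase hi)]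
        simp only [Pi.add_apply, hG]
        rw [h1 (fun i => if i ∈ insert a S then u i else h i),
          h1 (fun i => if i = a then fun y => u a y - h a y else if i ∈ S then u i else h i),
          h1 (fun i => if i ∈ S then u i else h i),
          h2 (fun i => if i ∈ insert a S then u i else h i)
            (fun i hi => by simp [hi]),
          h2 (fun i => if i = a then fun y => u a y - h a y else if i ∈ S then u i else h i)
            (fun i hi => by simp [hi])]
        simp [ha]
        ring
      have hm : ∀ i, Measurable (if i = a then fun y => u a y - h a y else
          if i ∈ S then u i else h i) := by
        intro i; split_ifs; exacts [(hu a).sub (hh a), hu i, hh i]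
      have h3 : eLpNorm (fun x : Fin d → ℝ => ∏ i, (if i = a then fun y => u a y - h a y else
          if i ∈ S then u i else h i) (x i)) 2 volume ≤ M ^ (d - 1) * δ := by
        rw [eLpNorm_prod hm, ← Finset.mul_prod_erase _ _ (Finset.mem_univ a), mul_comm]
        refine mul_le_mul' ?_ (by simpa using hd a)
        calc _ ≤ ∏ _i ∈ Finset.univ.erase a, M := by
              refine Finset.prod_le_prod' fun i hi => ?_
              rw [if_neg (Finset.ne_of_mem_erase hi)]
              split_ifs; exacts [huM i, hhM i]
          _ = M ^ (d - 1) := by simp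
      rw [e, Finset.card_insert_of_notMem ha]
      refine (eLpNorm_add_le (Finset.measurable_prod _ fun i _ =>
        (hm i).comp (measurable_pi_apply i)).aestronglyMeasurable
        ((hGm S).sub (hGm ∅)).aestronglyMeasurable (by norm_num)).trans ((add_le_add h3 ih).trans_eq ?_)
      push_cast
      ring
  have := key Finset.univ
  simpa [hG] using this

end Product

/-! ### Laws and densities of the two flows -/

section Law

variable {Ω : Type*} [MeasurableSpace Ω] {P : Measure Ω} [IsProbabilityMeasure P] {d : ℕ}
  {X Y Z : Ω → Fin d → ℝ}

/-- The law of the sum of two independent random vectors with product laws. -/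
lemma hasLaw_add_pi {μ ν : Fin d → Measure ℝ} [∀ i, IsProbabilityMeasure (μ i)]
    [∀ i, IsProbabilityMeasure (ν i)] (hX : HasLaw X (Measure.pi μ) P)
    (hY : HasLaw Y (Measure.pi ν) P) (h : IndepFun X Y P) :
    HasLaw (fun ω => X ω + Y ω) (Measure.pi fun i => μ i ∗ ν i) P where
  aemeasurable := hX.aemeasurable.add hY.aemeasurable
  map_eq := by
    have := h.map_add_eq_map_conv_map₀ hX.aemeasurable hY.aemeasurable
    rw [hX.map_eq, hY.map_eq, pi_conv_pi] at this
    exact this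

variable {m n : Fin d → Measure ℝ} [∀ i, IsProbabilityMeasure (m i)]
  [∀ i, IsProbabilityMeasure (n i)]

lemma measurable_prod_rnDeriv (m : Fin d → Measure ℝ) :
    Measurable fun x : Fin d → ℝ => ∏ i, (m i).rnDeriv volume (x i) :=
  Finset.measurable_prod _ fun i _ =>
    (Measure.measurable_rnDeriv (m i) volume).comp (measurable_pi_apply i)

omit [IsProbabilityMeasure P] in
lemma hasPDF_of_hasLaw_pi (hm : ∀ i, m i ≪ volume) (hY : HasLaw Y (Measure.pi m) P) :
    HasPDF Y P volume :=
  hasPDF_of_map_eq_withDensity hY.aemeasurable _ (measurable_prod_rnDeriv m).aemeasurable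
    (hY.map_eq.trans (pi_eq_withDensity m hm))

lemma pdf_toReal_ae_eq (hm : ∀ i, m i ≪ volume) (hY : HasLaw Y (Measure.pi m) P) :
    (fun x => (pdf Y P volume x).toReal) =ᵐ[volume] fun x => ∏ i, dens (m i) (x i) := by
  have := hasPDF_of_hasLaw_pi hm hY
  have h := (pdf.eq_of_map_eq_withDensity (X := Y) (μ := volume) _
    (measurable_prod_rnDeriv m).aemeasurable).1 (hY.map_eq.trans (pi_eq_withDensity m hm))
  filter_upwards [h] with x hx
  rw [hx, ENNReal.toReal_prod]
  rfl

lemma densityL2Dist_eq (hm : ∀ i, m i ≪ volume) (hn : ∀ i, n i ≪ volume)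
    (hY : HasLaw Y (Measure.pi m) P) (hZ : HasLaw Z (Measure.pi n) P) :
    densityL2Dist Y Z P =
      eLpNorm (fun x : Fin d → ℝ => ∏ i, dens (m i) (x i) - ∏ i, dens (n i) (x i)) 2 volume := by
  refine eLpNorm_congr_ae ?_
  filter_upwards [pdf_toReal_ae_eq hm hY, pdf_toReal_ae_eq hn hZ] with x h1 h2
  rw [h1, h2]

omit [IsProbabilityMeasure P] in
lemma IsWienerProcess.hasLaw_smul {W : ℝ≥0 → Ω → Fin d → ℝ} (h : IsWienerProcess W P) (σ : ℝ)
    (t : ℝ≥0) :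
    HasLaw (fun ω => σ • W t ω)
      (Measure.pi fun _ : Fin d => gaussianReal 0 ((σ ^ 2).toNNReal * t)) P := by
  have h1 : HasLaw (W t) (Measure.pi fun _ : Fin d => gaussianReal 0 t) P := by
    have h0 := h.law_increment 0 t zero_le
    rw [tsub_zero] at h0
    refine h0.congr ?_
    filter_upwards [h.start] with ω hω
    simp [hω]
  have h2 : HasLaw (fun x : Fin d → ℝ => σ • x)
      (Measure.pi fun _ : Fin d => gaussianReal 0 ((σ ^ 2).toNNReal * t))
      (Measure.pi fun _ : Fin d => gaussianReal 0 t) := by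
    refine ⟨by fun_prop, ?_⟩
    have e : (gaussianReal 0 t).map (fun x => σ * x) =
        gaussianReal 0 ((σ ^ 2).toNNReal * t) := by
      rw [gaussianReal_map_const_mul, mul_zero, Real.toNNReal_of_nonneg (sq_nonneg σ)]
    have : IsProbabilityMeasure ((gaussianReal 0 t).map fun x => σ * x) := by
      rw [e]; infer_instance
    have h3 := Measure.pi_map_pi (μ := fun _ : Fin d => gaussianReal 0 t)
      (f := fun _ x => σ * x) fun i => by fun_prop
    rw [e] at h3
    exact h3
  exact h2.comp h1

omit [IsProbabilityMeasure P] in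
lemma IsKacProcessMulti.hasLaw {a c : ℝ} {K : ℝ≥0 → Ω → Fin d → ℝ}
    (h : IsKacProcessMulti a c K P) (t : ℝ≥0) :
    HasLaw (K t) (Measure.pi fun i => P.map fun ω => K t ω i) P :=
  iIndepFun.hasLaw_pi (X := fun i ω => K t ω i)
    (fun i => ⟨(h.component i).aemeasurable t, rfl⟩)
    (h.indep.comp (fun _ p => p t) fun _ => measurable_pi_apply t)

end Law

section InitialDensity

variable {f : ℝ → ℝ}

lemma dens_withDensity_ae_eq (hf : IsProbDensity f) :
    dens (volume.withDensity fun x => ENNReal.ofReal (f x)) =ᵐ[volume] f := by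
  filter_upwards [Measure.rnDeriv_withDensity₀ volume hf.1.ennreal_ofReal, hf.2.1] with x h1 h2
  rw [dens, h1, ENNReal.toReal_ofReal h2]

lemma IsProbDensity.isProbabilityMeasure (hf : IsProbDensity f) :
    IsProbabilityMeasure (volume.withDensity fun x => ENNReal.ofReal (f x)) :=
  ⟨by rw [withDensity_apply _ .univ, Measure.restrict_univ]; exact hf.2.2⟩

end InitialDensity

/-! ### Splitting the bound into main term and remainder -/

section Bounds

/-- The constant `(2 π σ²)^{-1/4}` from the `L²` norm of the heat kernel. -/
noncomputable def heatConst (σ : ℝ) : ℝ := (2 * Real.pi * σ ^ 2)⁻¹ ^ (1 / 4 : ℝ)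

/-- An upper bound for the `L²` distance of the two flows in dimension `d`, where `L` bounds the
`L²` norms of the initial densities. -/
noncomputable def distBound (d : ℕ) (σ L a t : ℝ) : ℝ :=
  d * ((2 * heatConst σ * t ^ (-1 / 4 : ℝ) + 2 * Real.exp (-(a * t / 24)) * L) ^ (d - 1) *
    (16 * heatConst σ / a * t ^ (-5 / 4 : ℝ) + 3 * Real.exp (-(a * t / 24)) * L))

/-- The low-frequency part of `distBound`; it does not depend on the initial densities. -/
noncomputable def lowBound (d : ℕ) (σ a t : ℝ) : ℝ :=
  d * ((2 * heatConst σ * t ^ (-1 / 4 : ℝ)) ^ (d - 1) * (16 * heatConst σ / a * t ^ (-5 / 4 : ℝ)))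

/-- What remains of `distBound` after removing the low-frequency part for times `t ≥ 1`. -/
noncomputable def remainder (d : ℕ) (σ L a t : ℝ) : ℝ :=
  distBound d σ L a t - if 1 ≤ t then lowBound d σ a t else 0

variable {d : ℕ} {σ L a t : ℝ}

lemma heatConst_pos (hσ : 0 < σ) : 0 < heatConst σ := by
  unfold heatConst; positivity

lemma heatConst_mul_rpow (hσ : 0 < σ) (ht : 0 < t) :
    (8 * Real.pi * (σ ^ 2 * t / 4))⁻¹ ^ (1 / 4 : ℝ) = heatConst σ * t ^ (-1 / 4 : ℝ) := by
  have e : (8 * Real.pi * (σ ^ 2 * t / 4))⁻¹ = (2 * Real.pi * σ ^ 2)⁻¹ * t⁻¹ := by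
    field_simp; norm_num
  rw [e, Real.mul_rpow (by positivity) (by positivity), heatConst, neg_div,
    Real.rpow_neg ht.le, Real.inv_rpow ht.le]

lemma lowBound_nonneg (hσ : 0 < σ) (ha : 0 < a) (ht : 0 < t) : 0 ≤ lowBound d σ a t := by
  have := heatConst_pos hσ
  unfold lowBound; positivity

lemma lowBound_le_distBound (hσ : 0 < σ) (hL : 0 ≤ L) (ha : 0 < a) (ht : 0 < t) :
    lowBound d σ a t ≤ distBound d σ L a t := by
  have := heatConst_pos hσ
  unfold lowBound distBound
  gcongr
  · exact le_add_of_nonneg_right (by positivity)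
  · exact le_add_of_nonneg_right (by positivity)

lemma remainder_nonneg (hσ : 0 < σ) (hL : 0 ≤ L) (ha : 0 < a) (ht : 0 < t) :
    0 ≤ remainder d σ L a t := by
  have h1 := lowBound_nonneg (d := d) hσ ha ht
  have h2 := lowBound_le_distBound (d := d) hσ hL ha ht
  unfold remainder
  split_ifs <;> linarith

lemma remainder_le (hσ : 0 < σ) (ha : 0 < a) (ht : 0 < t) :
    remainder d σ L a t ≤ distBound d σ L a t := by
  have h1 := lowBound_nonneg (d := d) hσ ha ht
  unfold remainder
  split_ifs <;> linarith

/-- The left side decays like t^{-(1 + d/4)}, faster by t^{-1/4} than the first summand of the main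
term; for t ≥ 1 this surplus can be dropped. The second summand is only used as nonnegative. -/
lemma lowBound_le_mainTerm {c : ℝ} (hσ : 0 < σ) (ha : 0 < a) (hc : 0 < c) (hd : 1 ≤ d)
    (ht : 1 ≤ t) :
    lowBound d σ a t ≤
      d * (2 * heatConst σ) ^ (d - 1) * (16 * heatConst σ) * mainTerm d a c t := by
  have hκ := heatConst_pos hσ
  have ht0 : 0 < t := by linarith
  have e1 : (t ^ (-1 / 4 : ℝ)) ^ (d - 1) * t ^ (-5 / 4 : ℝ) ≤
      (t ^ (1 + ((d : ℝ) - 1) / 4))⁻¹ := by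
    rw [← Real.rpow_natCast, ← Real.rpow_mul ht0.le, ← Real.rpow_add ht0, ← Real.rpow_neg ht0.le,
      Nat.cast_sub hd]
    refine Real.rpow_le_rpow_of_exponent_le ht ?_
    push_cast
    linarith
  have e2 : (1 / a) * (t ^ (1 + ((d : ℝ) - 1) / 4))⁻¹ ≤ mainTerm d a c t := by
    have : 0 ≤ 1 / (c * a ^ (1 / 2 : ℝ) * t ^ (1 / 2 + ((d : ℝ) - 1) / 4)) := by positivity
    rw [mainTerm, one_div, one_div (a * _), mul_inv]
    linarith
  calc lowBound d σ a t = d * (2 * heatConst σ) ^ (d - 1) * (16 * heatConst σ) *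
        ((1 / a) * ((t ^ (-1 / 4 : ℝ)) ^ (d - 1) * t ^ (-5 / 4 : ℝ))) := by
        rw [lowBound, mul_pow]; ring
    _ ≤ d * (2 * heatConst σ) ^ (d - 1) * (16 * heatConst σ) *
        ((1 / a) * (t ^ (1 + ((d : ℝ) - 1) / 4))⁻¹) := by gcongr
    _ ≤ _ := by gcongr

lemma tendsto_exp_neg_mul_div (ht : 0 < t) :
    Tendsto (fun a : ℝ => Real.exp (-(a * t / 24))) atTop (𝓝 0) :=
  Real.tendsto_exp_neg_atTop_nhds_zero.comp
    ((tendsto_id.atTop_mul_const ht).atTop_div_const (by norm_num))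

/-- At fixed t the case distinction does not move with a. In both bounds the last factor tends to 0,
through 1/a and exp(-at/24), while the power in front converges. -/
lemma tendsto_remainder (ht : 0 < t) :
    Tendsto (fun a => remainder d σ L a t) atTop (𝓝 0) := by
  have he := tendsto_exp_neg_mul_div ht
  have hi : Tendsto (fun a : ℝ => 16 * heatConst σ / a * t ^ (-5 / 4 : ℝ)) atTop (𝓝 0) := by
    simpa using (tendsto_id.const_div_atTop (16 * heatConst σ)).mul_const (t ^ (-5 / 4 : ℝ))
  have h1 : Tendsto (fun a => distBound d σ L a t) atTop (𝓝 0) := by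
    have := (((((he.const_mul 2).mul_const L).const_add
      (2 * heatConst σ * t ^ (-1 / 4 : ℝ))).pow (d - 1)).mul
        (hi.add ((he.const_mul 3).mul_const L))).const_mul (d : ℝ)
    simpa [distBound] using this
  have h2 : Tendsto (fun a => lowBound d σ a t) atTop (𝓝 0) := by
    have := (hi.const_mul ((2 * heatConst σ * t ^ (-1 / 4 : ℝ)) ^ (d - 1))).const_mul (d : ℝ)
    simpa [lowBound] using this
  unfold remainder
  split_ifs
  · simpa using h1.sub h2
  · simpa using h1

lemma isBigO_rpow_of_le {r s : ℝ} (h : r ≤ s) :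
    (fun t : ℝ => t ^ r) =O[atTop] fun t : ℝ => t ^ s := by
  refine IsBigO.of_bound 1 ?_
  filter_upwards [eventually_ge_atTop 1] with t ht
  have : (0 : ℝ) ≤ t := by linarith
  rw [one_mul, Real.norm_of_nonneg (Real.rpow_nonneg this _),
    Real.norm_of_nonneg (Real.rpow_nonneg this _)]
  exact Real.rpow_le_rpow_of_exponent_le ht h

/-- The exponential terms are below every power of t, and (d - 1)/4 + 5/4 = 1 + d/4. -/
lemma isBigO_distBound (hd : 1 ≤ d) (ha : 0 < a) :
    (fun t => distBound d σ L a t) =O[atTop] fun t : ℝ => t ^ (-(1 + (d : ℝ) / 4)) := by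
  have he : ∀ r : ℝ, (fun t : ℝ => Real.exp (-(a * t / 24))) =O[atTop] fun t : ℝ => t ^ r := by
    intro r
    have := (isLittleO_exp_neg_mul_rpow_atTop (a := a / 24) (by positivity) r).isBigO
    refine this.congr_left fun t => ?_
    congr 1; ring
  have h1 : (fun t : ℝ => 2 * heatConst σ * t ^ (-1 / 4 : ℝ) +
      2 * Real.exp (-(a * t / 24)) * L) =O[atTop] fun t : ℝ => t ^ (-1 / 4 : ℝ) :=
    ((isBigO_refl _ _).const_mul_left _).add
      ((((he _).const_mul_left 2).const_mul_left L).congr_left fun t => by ring)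
  have h2 : (fun t : ℝ => 16 * heatConst σ / a * t ^ (-5 / 4 : ℝ) +
      3 * Real.exp (-(a * t / 24)) * L) =O[atTop] fun t : ℝ => t ^ (-5 / 4 : ℝ) :=
    ((isBigO_refl _ _).const_mul_left _).add
      ((((he _).const_mul_left 3).const_mul_left L).congr_left fun t => by ring)
  refine (((h1.pow (d - 1)).mul h2).const_mul_left (d : ℝ)).trans_eventuallyEq ?_
  filter_upwards [eventually_gt_atTop 0] with t ht
  rw [← Real.rpow_natCast, ← Real.rpow_mul ht.le, ← Real.rpow_add ht, Nat.cast_sub hd]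
  congr 1
  push_cast
  ring

lemma isBigO_remainder (hσ : 0 < σ) (hL : 0 ≤ L) (ha : 0 < a) (hd : 1 ≤ d) :
    (fun t => remainder d σ L a t) =O[atTop] fun t : ℝ => t ^ (-(1 / 2 + (d : ℝ) / 4)) := by
  refine (IsBigO.of_bound 1 ?_).trans
    ((isBigO_distBound (σ := σ) (L := L) hd ha).trans (isBigO_rpow_of_le (by linarith)))
  filter_upwards [eventually_gt_atTop 0] with t ht
  rw [one_mul, Real.norm_of_nonneg (remainder_nonneg hσ hL ha ht)]
  exact (remainder_le hσ ha ht).trans (Real.le_norm_self _)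

end Bounds

/-! ### The L² distance of the two flows -/

section Distance

variable {Ω : Type*} [MeasurableSpace Ω] {P : Measure Ω} [IsProbabilityMeasure P]

lemma charFun_gaussianReal_zero (v : ℝ≥0) (ξ : ℝ) :
    charFun (gaussianReal 0 v) ξ = ((Real.exp (-(v * ξ ^ 2 / 2)) : ℝ) : ℂ) := by
  rw [charFun_gaussianReal]
  push_cast
  congr 1
  ring

lemma ofReal_add_ofReal_mul_le {A B L : ℝ} {x : ℝ≥0∞} (hA : 0 ≤ A) (hB : 0 ≤ B) (hL : 0 ≤ L)
    (hx : x ≤ ENNReal.ofReal L) :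
    ENNReal.ofReal A + ENNReal.ofReal B * x ≤ ENNReal.ofReal (A + B * L) := by
  rw [ENNReal.ofReal_add hA (by positivity), ENNReal.ofReal_mul hB]
  gcongr

/-- One-dimensional estimates: smoothing by the heat kernel, smoothing by a Kac process, and the
distance between the two. -/
theorem eLpNorm_dens_kac_bounds {a c σ L : ℝ} (ha : 0 < a) (hσ : 0 < σ) (hL : 0 ≤ L)
    (hac : σ ^ 2 = c ^ 2 / a) {K : ℝ≥0 → Ω → ℝ} (hK : IsKacProcess a c K P) {t : ℝ≥0} (ht : 0 < t)
    {μ : Measure ℝ} [IsProbabilityMeasure μ] (hμ : μ ≪ volume) (hμ2 : MemLp (dens μ) 2)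
    (hμL : eLpNorm (dens μ) 2 volume ≤ ENNReal.ofReal L) :
    let γ := gaussianReal 0 ((σ ^ 2).toNNReal * t)
    let ν := P.map (K t)
    let e := Real.exp (-(a * t / 24))
    eLpNorm (dens (μ ∗ γ)) 2 volume ≤
        ENNReal.ofReal (2 * heatConst σ * (t : ℝ) ^ (-1 / 4 : ℝ) + 2 * e * L) ∧
      eLpNorm (dens (μ ∗ ν)) 2 volume ≤
        ENNReal.ofReal (2 * heatConst σ * (t : ℝ) ^ (-1 / 4 : ℝ) + 2 * e * L) ∧
      eLpNorm (fun x => dens (μ ∗ γ) x - dens (μ ∗ ν) x) 2 volume ≤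
        ENNReal.ofReal (16 * heatConst σ / a * (t : ℝ) ^ (-5 / 4 : ℝ) + 3 * e * L) := by
  intro γ ν e
  have ht' : (0 : ℝ) < t := ht
  have : IsProbabilityMeasure ν := Measure.isProbabilityMeasure_map (hK.aemeasurable t)
  have hκ := heatConst_pos hσ
  have he : 0 < e := Real.exp_pos _
  have hb : 0 < σ ^ 2 * t / 4 := by positivity
  -- The scaling c²/a = σ² enters here: the exponent w²t/(4a) of the telegraph bounds becomes bξ²
  -- with b = σ²t/4.
  have hw : ∀ ξ : ℝ, (c * ξ) ^ 2 * t / a = 4 * (σ ^ 2 * t / 4 * ξ ^ 2) := fun ξ => by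
    rw [hac]; field_simp
  have hγ : ∀ ξ, charFun γ ξ = ((Real.exp (-(4 * (σ ^ 2 * t / 4 * ξ ^ 2) / 2)) : ℝ) : ℂ) := by
    intro ξ
    rw [charFun_gaussianReal_zero]
    congr 3
    rw [NNReal.coe_mul, Real.coe_toNNReal _ (sq_nonneg σ)]
    ring
  have hrp : (t : ℝ) ^ (-5 / 4 : ℝ) = (t : ℝ)⁻¹ * (t : ℝ) ^ (-1 / 4 : ℝ) := by
    rw [← Real.rpow_neg_one, ← Real.rpow_add ht']; norm_num
  refine ⟨?_, ?_, ?_⟩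
  -- The heat kernel satisfies a better bound; A = 2 and B = 2e match those of the Kac law, because
  -- the telescoping estimate uses one M for both.
  · refine (eLpNorm_dens_conv_le hμ hμ2 (A := 2) (B := 2 * e) two_pos.le (by positivity) hb
      fun ξ => ?_).trans ?_
    · rw [hγ, Complex.norm_real, Real.norm_of_nonneg (Real.exp_pos _).le]
      have : Real.exp (-(4 * (σ ^ 2 * t / 4 * ξ ^ 2) / 2)) ≤
          Real.exp (-(σ ^ 2 * t / 4 * ξ ^ 2)) := by
        have : 0 ≤ σ ^ 2 * t / 4 * ξ ^ 2 := by positivity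
        exact Real.exp_le_exp.2 (by linarith)
      linarith [Real.exp_pos (-(σ ^ 2 * t / 4 * ξ ^ 2))]
    · rw [heatConst_mul_rpow hσ ht', ← mul_assoc]
      exact ofReal_add_ofReal_mul_le (by positivity) (by positivity) hL hμL
  · refine (eLpNorm_dens_conv_le hμ hμ2 (A := 2) (B := 2 * e) two_pos.le (by positivity) hb
      fun ξ => ?_).trans ?_
    · obtain ⟨p, q, hpq, hp⟩ := hK.exists_charFun_eq ha.le ξ
      rw [hp, Complex.norm_real, Real.norm_eq_abs]
      have := hpq.abs_le_exp ha ht'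
      rwa [hw, mul_div_cancel_left₀ _ (by norm_num : (4 : ℝ) ≠ 0)] at this
    · rw [heatConst_mul_rpow hσ ht', ← mul_assoc]
      exact ofReal_add_ofReal_mul_le (by positivity) (by positivity) hL hμL
  · refine (eLpNorm_dens_conv_sub_le hμ hμ2 (A := 16 / (a * t)) (B := 3 * e) (by positivity)
      (by positivity) hb fun ξ => ?_).trans ?_
    · obtain ⟨p, q, hpq, hp⟩ := hK.exists_charFun_eq ha.le ξ
      rw [hp, hγ, ← Complex.ofReal_sub, Complex.norm_real, Real.norm_eq_abs, abs_sub_comm]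
      have := hpq.abs_sub_exp_le ha ht'
      rwa [hw, mul_div_cancel_left₀ _ (by norm_num : (4 : ℝ) ≠ 0)] at this
    · have e1 : 16 / (a * t) * (heatConst σ * (t : ℝ) ^ (-1 / 4 : ℝ)) =
          16 * heatConst σ / a * (t : ℝ) ^ (-5 / 4 : ℝ) := by
        rw [hrp]; field_simp
      rw [heatConst_mul_rpow hσ ht', e1]
      exact ofReal_add_ofReal_mul_le (by positivity) (by positivity) hL hμL

/-- The sum of the `L²` norms of the initial densities. -/
noncomputable def initNorm {d : ℕ} (f : Fin d → ℝ → ℝ) : ℝ :=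
  ∑ i, (eLpNorm (f i) 2 volume).toReal

lemma initNorm_nonneg {d : ℕ} (f : Fin d → ℝ → ℝ) : 0 ≤ initNorm f :=
  Finset.sum_nonneg fun _ _ => ENNReal.toReal_nonneg

variable {d : ℕ} {a c σ : ℝ} {f : Fin d → ℝ → ℝ} {X₀ : Ω → Fin d → ℝ} {K W : ℝ≥0 → Ω → Fin d → ℝ}

/-- The laws of the heat flow and of the Kac flow are products of one-dimensional laws. -/
theorem hasLaw_flows (hf : ∀ i, IsProbDensity (f i))
    (hX : ∀ i, HasLaw (fun ω => X₀ ω i)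
      (volume.withDensity fun x => ENNReal.ofReal (f i x)) P)
    (hXi : iIndepFun (fun i ω => X₀ ω i) P) (hK : IsKacProcessMulti a c K P)
    (hW : IsWienerProcess W P) (t : ℝ≥0) (hXK : IndepFun X₀ (K t) P)
    (hXW : IndepFun X₀ (fun ω => σ • W t ω) P) :
    HasLaw (fun ω => X₀ ω + K t ω)
      (Measure.pi fun i => (volume.withDensity fun x => ENNReal.ofReal (f i x)) ∗
        P.map fun ω => K t ω i) P ∧
    HasLaw (fun ω => X₀ ω + σ • W t ω)
      (Measure.pi fun i => (volume.withDensity fun x => ENNReal.ofReal (f i x)) ∗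
        gaussianReal 0 ((σ ^ 2).toNNReal * t)) P := by
  have h1 := fun i => (hf i).isProbabilityMeasure
  have h2 : ∀ i, IsProbabilityMeasure (P.map fun ω => K t ω i) := fun i =>
    Measure.isProbabilityMeasure_map ((hK.component i).aemeasurable t)
  have hX0 := iIndepFun.hasLaw_pi (X := fun i ω => X₀ ω i) hX hXi
  exact ⟨hasLaw_add_pi hX0 (hK.hasLaw t) hXK, hasLaw_add_pi hX0 (hW.hasLaw_smul σ t) hXW⟩

/-- The `L²` distance between the heat flow and the Kac flow. -/
theorem densityL2Dist_le (ha : 0 < a) (hσ : 0 < σ) (hac : σ ^ 2 = c ^ 2 / a)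
    (hf : ∀ i, IsProbDensity (f i)) (hf2 : ∀ i, MemLp (f i) 2 volume)
    (hX : ∀ i, HasLaw (fun ω => X₀ ω i)
      (volume.withDensity fun x => ENNReal.ofReal (f i x)) P)
    (hXi : iIndepFun (fun i ω => X₀ ω i) P) (hK : IsKacProcessMulti a c K P)
    (hW : IsWienerProcess W P) {t : ℝ≥0} (ht : 0 < t) (hXK : IndepFun X₀ (K t) P)
    (hXW : IndepFun X₀ (fun ω => σ • W t ω) P) :
    densityL2Dist (fun ω => X₀ ω + σ • W t ω) (fun ω => X₀ ω + K t ω) P ≤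
      ENNReal.ofReal (distBound d σ (initNorm f) a t) := by
  obtain ⟨hlK, hlW⟩ := hasLaw_flows hf hX hXi hK hW t hXK hXW
  have h1 := fun i => (hf i).isProbabilityMeasure
  have h2 : ∀ i, IsProbabilityMeasure (P.map fun ω => K t ω i) := fun i =>
    Measure.isProbabilityMeasure_map ((hK.component i).aemeasurable t)
  have hac' : ∀ i, (volume.withDensity fun x => ENNReal.ofReal (f i x)) ≪ volume :=
    fun i => withDensity_absolutelyContinuous _ _
  rw [densityL2Dist_eq (fun i => conv_ac (hac' i) _) (fun i => conv_ac (hac' i) _) hlW hlK]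
  have hL := initNorm_nonneg f
  have hdens : ∀ i, eLpNorm (dens (volume.withDensity fun x => ENNReal.ofReal (f i x))) 2 volume ≤
      ENNReal.ofReal (initNorm f) := by
    intro i
    rw [eLpNorm_congr_ae (dens_withDensity_ae_eq (hf i)),
      ← ENNReal.ofReal_toReal (hf2 i).eLpNorm_ne_top]
    exact ENNReal.ofReal_le_ofReal (Finset.single_le_sum
      (f := fun i => (eLpNorm (f i) 2 volume).toReal)
      (fun _ _ => ENNReal.toReal_nonneg) (Finset.mem_univ i))
  have hb := fun i => eLpNorm_dens_kac_bounds ha hσ hL hac (hK.component i) ht (hac' i)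
    ((memLp_congr_ae (dens_withDensity_ae_eq (hf i))).2 (hf2 i)) (hdens i)
  refine (eLpNorm_prod_sub_prod_le (fun i => measurable_dens _) (fun i => measurable_dens _)
    (fun i => (hb i).1) (fun i => (hb i).2.1) (fun i => (hb i).2.2)).trans_eq ?_
  have hκ := heatConst_pos hσ
  rw [distBound, ENNReal.ofReal_mul (by positivity), ENNReal.ofReal_natCast,
    ENNReal.ofReal_mul (by positivity), ENNReal.ofReal_pow (by positivity)]

end Distance

end KacFlow

/-! ### The main theorem -/

theorem theorem5p5 (d : ℕ) (hd : 1 ≤ d) (c₀ σ : ℝ) (hc₀ : 0 < c₀) (hσ : 0 < σ) :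
    ∃ C : ℝ, 0 < C ∧
      ∀ f : Fin d → ℝ → ℝ, (∀ i, KacFlow.IsProbDensity (f i)) → (∀ i, KacFlow.MemH2 (f i)) →
        ∃ R : ℝ → ℝ → ℝ → ℝ,
          (∀ t : ℝ, 0 < t →
            Tendsto (fun p : ℝ × ℝ => R p.1 p.2 t) (atTop ×ˢ atTop) (𝓝 0)) ∧
          (∀ a c : ℝ, 0 < a → c₀ ≤ c →
            (fun t : ℝ => R a c t) =O[atTop] fun t : ℝ => t ^ (-(1 / 2 + (d : ℝ) / 4))) ∧
          ∀ a c : ℝ, 0 < a → c₀ ≤ c → σ ^ 2 = c ^ 2 / a →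
            ∀ {Ω : Type*} [MeasurableSpace Ω] (P : Measure Ω) [IsProbabilityMeasure P]
              (X₀ : Ω → Fin d → ℝ) (K W : ℝ≥0 → Ω → Fin d → ℝ),
              (∀ i, HasLaw (fun ω => X₀ ω i)
                (volume.withDensity fun x => ENNReal.ofReal (f i x)) P) →
              iIndepFun (fun i ω => X₀ ω i) P →
              KacFlow.IsKacProcessMulti a c K P →
              KacFlow.IsWienerProcess W P →
              (∀ t, IndepFun X₀ (K t) P) →
              (∀ t, IndepFun X₀ (fun ω => σ • W t ω) P) →
              (∀ t, HasPDF (fun ω => X₀ ω + K t ω) P volume ∧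
                HasPDF (fun ω => X₀ ω + σ • W t ω) P volume) ∧
              (∀ t : ℝ≥0, 0 < t →
                KacFlow.densityL2Dist (fun ω => X₀ ω + σ • W t ω) (fun ω => X₀ ω + K t ω) P ≤
                  ENNReal.ofReal (C * KacFlow.mainTerm d a c t + R a c t)) ∧
              (fun t : ℝ≥0 => (KacFlow.densityL2Dist (fun ω => X₀ ω + σ • W t ω)
                (fun ω => X₀ ω + K t ω) P).toReal) =O[atTop]
                  fun t : ℝ≥0 => (t : ℝ) ^ (-(1 / 2 + ((d : ℝ) - 1) / 4)) := by
  have hκ := KacFlow.heatConst_pos hσ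
  have hd0 : (0 : ℝ) < d := by exact_mod_cast hd
  -- C is the coefficient in `lowBound_le_mainTerm`; R depends on the initial densities only through
  -- `initNorm`, and is constant in c.
  refine ⟨d * (2 * KacFlow.heatConst σ) ^ (d - 1) * (16 * KacFlow.heatConst σ), by positivity,
    fun f hf hf2 => ⟨fun a _ t => KacFlow.remainder d σ (KacFlow.initNorm f) a t,
      fun t ht => (KacFlow.tendsto_remainder ht).comp tendsto_fst,
      fun a _ ha _ => KacFlow.isBigO_remainder hσ (KacFlow.initNorm_nonneg f) ha hd, ?_⟩⟩
  intro a c ha hc hac Ω _ P _ X₀ K W hX hXi hK hW hXK hXW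
  have hdist : ∀ t : ℝ≥0, 0 < t →
      KacFlow.densityL2Dist (fun ω => X₀ ω + σ • W t ω) (fun ω => X₀ ω + K t ω) P ≤
        ENNReal.ofReal (KacFlow.distBound d σ (KacFlow.initNorm f) a t) := fun t ht =>
    KacFlow.densityL2Dist_le ha hσ hac hf (fun i => (hf2 i).1) hX hXi hK hW ht (hXK t) (hXW t)
  refine ⟨fun t => ?_, fun t ht => ?_, ?_⟩
  · obtain ⟨hlK, hlW⟩ := KacFlow.hasLaw_flows hf hX hXi hK hW t (hXK t) (hXW t)
    have h1 := fun i => (hf i).isProbabilityMeasure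
    have h2 : ∀ i, IsProbabilityMeasure (P.map fun ω => K t ω i) := fun i =>
      Measure.isProbabilityMeasure_map ((hK.component i).aemeasurable t)
    have hac' : ∀ i, (volume.withDensity fun x => ENNReal.ofReal (f i x)) ≪ volume :=
      fun i => withDensity_absolutelyContinuous _ _
    -- Absolute continuity is inherited from the initial law alone, so t = 0 and the atoms of the
    -- Kac law do no harm.
    exact ⟨KacFlow.hasPDF_of_hasLaw_pi (fun i => KacFlow.conv_ac (hac' i) _) hlK,
      KacFlow.hasPDF_of_hasLaw_pi (fun i => KacFlow.conv_ac (hac' i) _) hlW⟩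
  · refine (hdist t ht).trans (ENNReal.ofReal_le_ofReal ?_)
    have hc0 : 0 < c := hc₀.trans_le hc
    have ht' : (0 : ℝ) < t := ht
    have hm : 0 ≤ KacFlow.mainTerm d a c t := by unfold KacFlow.mainTerm; positivity
    simp only [KacFlow.remainder]
    split_ifs with h1
    · linarith [KacFlow.lowBound_le_mainTerm hσ ha hc0 hd h1]
    · have : 0 ≤ d * (2 * KacFlow.heatConst σ) ^ (d - 1) * (16 * KacFlow.heatConst σ) *
        KacFlow.mainTerm d a c t := by positivity
      linarith
  -- The full bound decays like t^{-(1 + d/4)}, faster than claimed, so the splitting into main term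
  -- and remainder is not needed here.
  · have hO := ((KacFlow.isBigO_distBound (σ := σ) (L := KacFlow.initNorm f) hd ha).trans
      (KacFlow.isBigO_rpow_of_le (s := -(1 / 2 + ((d : ℝ) - 1) / 4)) (by linarith))).comp_tendsto
      (NNReal.tendsto_coe_atTop.2 tendsto_id)
    refine (IsBigO.of_bound 1 ?_).trans hO
    filter_upwards [eventually_gt_atTop 0] with t ht
    have hb := ENNReal.toReal_mono ENNReal.ofReal_ne_top (hdist t ht)
    rw [one_mul, Real.norm_of_nonneg ENNReal.toReal_nonneg]
    refine hb.trans ?_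
    rw [ENNReal.toReal_ofReal']
    exact max_le (Real.le_norm_self _) (norm_nonneg _)
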